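/- Let $n\ge 2$, let $S^{n-1}$ be the unit sphere of $\mathbb R^n$ with its canonical spherical Lebesgue measure $d\xi$, and let $V$ be the $n$-dimensional volume. Let $\mathcal C$ be the set of functions $\Psi:S^{n-1}\times(0,\infty)\to\mathbb R$ such that $\Psi$ and its partial derivative $\Psi_t=\partial\Psi/\partial t$ are continuous, let $\mathcal C_I$ (resp. $\mathcal C_d$) be the set of $\Psi\in\mathcal C$ with $\Psi_t>0$ (resp. $\Psi_t<0$) on $S^{n-1}\times(0,\infty)$, and let $\Psi\in\mathcal C_I\cup\mathcal C_d$. Let $\Omega\subseteq S^{n-1}$ be a closed set that is not contained in any closed hemisphere, let $f:\Omega\to(0,\infty)$ and $g:\Omega\to\mathbb R$ be continuous, and let $$[f]=\bigcap_{\xi\in\Omega}\{x\in\mathbb R^n: x\cdot\xi\le f(\xi)\}$$ be the Wulff shape of $f$, defined in the same way for every positive function on $\Omega$. For a convex body $K$ with the origin in its interior write $h_K(u)=\max_{y\in K}u\cdot y$, $\rho_K(\xi)=\max\{r\ge 0: r\xi\in K\}$ and $\boldsymbol\nu_K^{-1}(\omega)=\{x\in\partial K: x\cdot u=h_K(u)\text{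 for some }u\in\omega\}$ for $\omega\subseteq S^{n-1}$. Put $\boldsymbol\alpha_K^*(\omega)=\{\xi\in S^{n-1}:\rho_K(\xi)\xi\in\boldsymbol\nu_K^{-1}(\omega)\}$, and let $\alpha_K(\xi)$ be, for almost every $\xi\in S^{n-1}$, the unique outer unit normal vector of $K$ at $\rho_K(\xi)\xi$. The Musielak-Orlicz surface area measure $S_\Psi(K,\cdot)$ is the finite signed Borel measure on $S^{n-1}$ with $$S_\Psi(K,\omega)=\int_{\boldsymbol\alpha_K^*(\omega)}\frac{\rho_K(\xi)^n}{h_K(\alpha_K(\xi))\,\Psi_t\big(\alpha_K(\xi),h_K(\alpha_K(\xi))\big)}\,d\xi\qquad\text{for all Borel }\omega\subseteq S^{n-1},$$ and the surface area measure is $S(K,\omega)=\mathscr H^{n-1}(\boldsymbol\nu_K^{-1}(\omega))$, where the Hausdorff measure $\mathscr H^{n-1}$ is normalized to agree with $(n-1)$-dimensional Euclidean volume. Then the following hold. (a) There is $\delta>0$ such that for all $|\varepsilon|<\delta$ and $\xi\in\Omega$ there is a number $f_\varepsilon(\xi)>0$ (necessarily unique, as $\Psi(\xi,\cdot)$ is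 strictly monotone) with $\Psi(\xi,f_\varepsilon(\xi))=\Psi(\xi,f(\xi))+\varepsilon g(\xi)$. (b) The finite signed measure $S_\Psi([f],\cdot)$ exists, $S([f],\cdot)$ is a Borel measure, and $$\frac{dS_\Psi([f],u)}{dS([f],u)}=\frac1{\Psi_t(u,h_{[f]}(u))},$$ this density being integrable with respect to $S([f],\cdot)$. (c) The function $g$ is integrable on $\Omega$ with respect to $S_\Psi([f],\cdot)$, and $$\lim_{\varepsilon\to0}\frac{V([f_\varepsilon])-V([f])}{\varepsilon}=\int_\Omega g(u)\,dS_\Psi([f],u).$$ -/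

import Mathlib

open Set Filter Topology MeasureTheory

noncomputable section

namespace MusielakOrlicz

/-- The Euclidean space `ℝⁿ`. -/
abbrev Space (n : ℕ) : Type := EuclideanSpace ℝ (Fin n)

/-- The unit sphere `S^{n-1}` of `ℝⁿ`. -/
abbrev Sph (n : ℕ) : Type := Metric.sphere (0 : Space n) 1

variable {n : ℕ}

/-- The canonical spherical Lebesgue measure `dξ` on `S^{n-1}`. -/
def sphMeasure (n : ℕ) : Measure (Sph n) := (volume : Measure (Space n)).toSphere

/-- The partial derivative `Ψ_t` of `Ψ : S^{n-1} × (0, ∞) → ℝ` in the second variable.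
The values of `Ψ` at `t ≤ 0` play no role. -/
def partialT (Ψ : Sph n → ℝ → ℝ) (ξ : Sph n) (t : ℝ) : ℝ := deriv (Ψ ξ) t

/-- The class `𝒞`: `Ψ` and `Ψ_t` exist and are continuous on `S^{n-1} × (0, ∞)`. -/
structure IsClassC (Ψ : Sph n → ℝ → ℝ) : Prop where
  continuousOn : ContinuousOn (fun p : Sph n × ℝ => Ψ p.1 p.2) (univ ×ˢ Ioi 0)
  differentiableAt : ∀ ξ, ∀ t, 0 < t → DifferentiableAt ℝ (Ψ ξ) t
  continuousOn_partialT :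
    ContinuousOn (fun p : Sph n × ℝ => partialT Ψ p.1 p.2) (univ ×ˢ Ioi 0)

/-- The class `𝒞_I`: functions of class `𝒞` with `Ψ_t > 0`. -/
def IsClassCI (Ψ : Sph n → ℝ → ℝ) : Prop :=
  IsClassC Ψ ∧ ∀ ξ, ∀ t, 0 < t → 0 < partialT Ψ ξ t

/-- The class `𝒞_d`: functions of class `𝒞` with `Ψ_t < 0`. -/
def IsClassCd (Ψ : Sph n → ℝ → ℝ) : Prop :=
  IsClassC Ψ ∧ ∀ ξ, ∀ t, 0 < t → partialT Ψ ξ t < 0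

/-- The closed hemisphere with pole `v`. -/
def closedHemisphere (v : Sph n) : Set (Sph n) :=
  {ξ | 0 ≤ inner ℝ (v : Space n) (ξ : Space n)}

/-- The Wulff shape `[f] = ⋂_{ξ ∈ Ω} {x : x ⬝ ξ ≤ f ξ}`. -/
def wulffShape (Ω : Set (Sph n)) (f : Sph n → ℝ) : Set (Space n) :=
  ⋂ ξ ∈ Ω, {x : Space n | inner ℝ x (ξ : Space n) ≤ f ξ}

/-- The Musielak-Orlicz addition `f_ε(ξ) = ψ_ξ⁻¹(ψ_ξ(f(ξ)) + ε g(ξ))`, where `ψ_ξ = Ψ(ξ, ·)` on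
`(0, ∞)`. It is meaningful when `ψ_ξ(f(ξ)) + ε g(ξ)` lies in the range of `ψ_ξ`. -/
def moAdd (Ψ : Sph n → ℝ → ℝ) (f g : Sph n → ℝ) (ε : ℝ) (ξ : Sph n) : ℝ :=
  Function.invFunOn (Ψ ξ) (Ioi 0) (Ψ ξ (f ξ) + ε * g ξ)

/-- The support function `h_K`. -/
def supportFn (K : Set (Space n)) (x : Space n) : ℝ :=
  sSup ((fun y : Space n => inner ℝ x y) '' K)

/-- The radial function `ρ_K`. -/
def radialFn (K : Set (Space n)) (x : Space n) : ℝ :=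
  sSup {r : ℝ | 0 ≤ r ∧ r • x ∈ K}

/-- The radial map `r_K(ξ) = ρ_K(ξ) ξ`. -/
def radialMap (K : Set (Space n)) (ξ : Sph n) : Space n :=
  radialFn K (ξ : Space n) • (ξ : Space n)

/-- The (set-valued) Gauss map `ν_K(x) = {u ∈ S^{n-1} : x ⬝ u = h_K(u)}`, for `x ∈ ∂K`. -/
def gaussMap (K : Set (Space n)) (x : Space n) : Set (Sph n) :=
  {u | inner ℝ x (u : Space n) = supportFn K (u : Space n)}

/-- The inverse Gauss image `ν_K⁻¹(ω) = {x ∈ ∂K : ν_K(x) ∩ ω ≠ ∅}`. -/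
def invGaussImage (K : Set (Space n)) (ω : Set (Sph n)) : Set (Space n) :=
  {x | x ∈ frontier K ∧ (gaussMap K x ∩ ω).Nonempty}

/-- The reverse radial Gauss image `α*_K(ω) = r_K⁻¹(ν_K⁻¹(ω))`. -/
def revRadialGaussImage (K : Set (Space n)) (ω : Set (Sph n)) : Set (Sph n) :=
  radialMap K ⁻¹' invGaussImage K ω

/-- The radial Gauss image `α_K(ξ) = ν_K(r_K(ξ))` as a set. -/
def radialGaussImage (K : Set (Space n)) (ξ : Sph n) : Set (Sph n) :=
  gaussMap K (radialMap K ξ)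

open Classical in
/-- The radial Gauss map `α_K`: the unique element of the radial Gauss image of `ξ`. Where that
image is not a singleton (a null set of `ξ` for convex bodies with the origin inside) the value is
irrelevant. -/
def radialGaussMap (K : Set (Space n)) (ξ : Sph n) : Sph n :=
  if h : ∃! u, u ∈ radialGaussImage K ξ then h.choose else ξ

/-- The integrand `ρ_K(ξ)ⁿ / (h_K(α_K(ξ)) Ψ_t(α_K(ξ), h_K(α_K(ξ))))`. -/
def moIntegrand (Ψ : Sph n → ℝ → ℝ) (K : Set (Space n)) (ξ : Sph n) : ℝ :=
  radialFn K (ξ : Space n) ^ n /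
    (supportFn K (radialGaussMap K ξ : Space n) *
      partialT Ψ (radialGaussMap K ξ) (supportFn K (radialGaussMap K ξ : Space n)))

/-- `S` is the Musielak-Orlicz surface area measure `S_Ψ(K, ·)`: the finite signed Borel measure
on `S^{n-1}` whose value at every Borel set `ω` is
`∫_{α*_K(ω)} ρ_K(ξ)ⁿ / (h_K(α_K(ξ)) Ψ_t(α_K(ξ), h_K(α_K(ξ)))) dξ`
(in particular the integrand is integrable and the sets `α*_K(ω)` are Lebesgue measurable).
It is determined uniquely by these values. -/
structure IsMOSurfaceAreaMeasure (Ψ : Sph n → ℝ → ℝ) (K : Set (Space n))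
    (S : SignedMeasure (Sph n)) : Prop where
  integrable : Integrable (moIntegrand Ψ K) (sphMeasure n)
  nullMeasurableSet : ∀ ω : Set (Sph n), MeasurableSet ω →
    NullMeasurableSet (revRadialGaussImage K ω) (sphMeasure n)
  apply_eq : ∀ ω : Set (Sph n), MeasurableSet ω →
    S ω = ∫ ξ in revRadialGaussImage K ω, moIntegrand Ψ K ξ ∂(sphMeasure n)

/-- `σ` is the classical surface area measure `S(K, ·)`: the Borel measure on `S^{n-1}` with
`S(K, ω) = ℋ^{n-1}(ν_K⁻¹(ω))` for every Borel set `ω`, where `ℋ^{n-1}` is the Hausdorff measure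
normalized to agree with `(n-1)`-dimensional Euclidean volume. -/
def IsSurfaceAreaMeasure (K : Set (Space n)) (σ : Measure (Sph n)) : Prop :=
  ∀ ω : Set (Sph n), MeasurableSet ω →
    σ ω = Measure.euclideanHausdorffMeasure (n - 1) (invGaussImage K ω)

end MusielakOrlicz

end

/-! With `Q = {ξ / f(ξ) : ξ ∈ Ω}`, the Wulff shape `K = [f]` is the polar body of `Q`: the support
function `h_Q` is its gauge, and `ρ_K = 1 / h_Q`. Polar coordinates give `n V(K) = ∫ h_Q⁻ⁿ dξ`, so
the volume varies through the support functions of the sets `Q_ε` built from `f_ε`, each a supremum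
of linear functionals over `Ω`.

By Rademacher's theorem `h_Q` is differentiable in almost every direction `ξ`. There `∇h_Q(ξ)` is
the unique maximizer `η / f(η)` in `Q`, `η ∈ Ω` is the outer normal of `K` at `ρ_K(ξ) ξ`, and
`h_K(η) = 1 / ‖∇h_Q(ξ)‖ = f(η)`. Danskin's theorem (`tendsto_supportFn_sub_div`) together with `∂_ε
f_ε = g / Ψ_t` gives the derivative `-h_Q ‖∇h_Q‖ g(η) / Ψ_t(η, h_K(η))` of the support function at
`ε = 0`. Dominated convergence then gives the derivative of the volume as an integral over
directions (`tendsto_volume_wulffShape_sub_div`).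

To read this integral on the side of normals, the area formula
`euclideanHausdorffMeasure_comap_levelMap` shows that the radial map has Jacobian `h_Q⁻ⁿ ‖∇h_Q‖ =
ρ_Kⁿ / h_K(α_K)`. Hence `S(K, ·)` is the image of that density under the normal map, and dividing by
`Ψ_t` gives `S_Ψ(K, ·)`. The area formula is obtained by comparing the boundary near a point of
differentiability with its tangent hyperplane, up to factors tending to 1. -/

noncomputable section

namespace MusielakOrlicz

variable {n : ℕ}

/-! ### Support functions and their differentiability -/

section SupportFn

variable {Q : Set (Space n)} {x y p : Space n}

theorem inner_le_supportFn (hQ : Bornology.IsBounded Q) (hp : p ∈ Q) (x : Space n) :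
    inner ℝ x p ≤ supportFn Q x := by
  obtain ⟨C, hC⟩ := hQ.exists_norm_le
  refine le_csSup ⟨‖x‖ * C, ?_⟩ (mem_image_of_mem _ hp)
  rintro _ ⟨q, hq, rfl⟩
  exact (real_inner_le_norm x q).trans (by gcongr; exact hC q hq)

theorem supportFn_le (hQ : Q.Nonempty) {c : ℝ} (h : ∀ q ∈ Q, inner ℝ x q ≤ c) :
    supportFn Q x ≤ c := by
  refine csSup_le (hQ.image _) ?_
  rintro _ ⟨q, hq, rfl⟩
  exact h q hq

theorem supportFn_smul (Q : Set (Space n)) {c : ℝ} (hc : 0 ≤ c) (x : Space n) :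
    supportFn Q (c • x) = c * supportFn Q x := by
  unfold supportFn
  rw [← smul_eq_mul, ← Real.sSup_smul_of_nonneg hc, ← image_smul, image_image]
  simp [inner_smul_left]

theorem exists_mem_lt_inner (hQ : Q.Nonempty) {c : ℝ} (h : c < supportFn Q x) :
    ∃ q ∈ Q, c < inner ℝ x q := by
  obtain ⟨_, ⟨q, hq, rfl⟩, hlt⟩ := exists_lt_of_lt_csSup (hQ.image _) h
  exact ⟨q, hq, hlt⟩

theorem exists_inner_eq_supportFn (hQ : IsCompact Q) (hQ' : Q.Nonempty) (x : Space n) :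
    ∃ q ∈ Q, inner ℝ x q = supportFn Q x := by
  obtain ⟨q, hq, h⟩ := hQ.exists_sSup_image_eq hQ'
    (f := fun y : Space n => inner ℝ x y) (by fun_prop)
  exact ⟨q, hq, h.symm⟩

theorem supportFn_sub_le {C : ℝ} (hC : ∀ q ∈ Q, ‖q‖ ≤ C) (hQ : Q.Nonempty) (x y : Space n) :
    supportFn Q x - supportFn Q y ≤ C * ‖x - y‖ := by
  rw [sub_le_iff_le_add]
  refine supportFn_le hQ fun q hq => ?_
  have h1 := inner_le_supportFn (isBounded_iff_forall_norm_le.2 ⟨C, hC⟩) hq y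
  have h2 : inner ℝ (x - y) q ≤ C * ‖x - y‖ :=
    (real_inner_le_norm _ _).trans (by rw [mul_comm]; gcongr; exact hC q hq)
  rw [inner_sub_left] at h2
  linarith

theorem exists_lipschitzWith_supportFn (hQ : Bornology.IsBounded Q) (hQ' : Q.Nonempty) :
    ∃ C, LipschitzWith C (supportFn Q) := by
  obtain ⟨C, hC⟩ := hQ.exists_norm_le
  have hC0 : 0 ≤ C := (norm_nonneg _).trans (hC _ hQ'.some_mem)
  refine ⟨⟨C, hC0⟩, LipschitzWith.of_le_add_mul _ fun x y => ?_⟩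
  have := supportFn_sub_le hC hQ' x y
  rw [dist_eq_norm]
  exact (sub_le_iff_le_add'.1 this)

theorem continuous_supportFn (hQ : Bornology.IsBounded Q) (hQ' : Q.Nonempty) :
    Continuous (supportFn Q) :=
  (exists_lipschitzWith_supportFn hQ hQ').choose_spec.continuous

/-- A linear minorant of a differentiable function touching it at a point is its gradient. -/
theorem gradient_eq_of_inner_le {G : Space n → ℝ} (hG : DifferentiableAt ℝ G x)
    (hle : ∀ y, inner ℝ y p ≤ G y) (heq : inner ℝ x p = G x) : gradient G x = p := by
  have hmin : IsLocalMin (fun y => G y - inner ℝ p y) x := by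
    refine Eventually.of_forall fun y => ?_
    have := hle y
    rw [real_inner_comm] at heq this
    show G x - inner ℝ p x ≤ G y - inner ℝ p y
    linarith
  have hd : HasFDerivAt (fun y => G y - inner ℝ p y)
      (fderiv ℝ G x - innerSL ℝ p) x := hG.hasFDerivAt.sub (innerSL ℝ p).hasFDerivAt
  have h0 := hmin.hasFDerivAt_eq_zero hd
  refine ext_inner_right ℝ fun y => ?_
  have h1 : fderiv ℝ G x y = inner ℝ p y := by
    have := congrArg (fun l => l y) h0
    simpa [sub_eq_zero] using this
  rw [← h1]
  simp [gradient]

theorem inner_gradient_supportFn (hQ : IsCompact Q) (hQ' : Q.Nonempty)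
    (hd : DifferentiableAt ℝ (supportFn Q) x) :
    gradient (supportFn Q) x ∈ Q ∧ inner ℝ x (gradient (supportFn Q) x) = supportFn Q x := by
  obtain ⟨q, hq, h⟩ := exists_inner_eq_supportFn hQ hQ' x
  have := gradient_eq_of_inner_le hd (fun y => inner_le_supportFn hQ.isBounded hq y) h
  rw [this]
  exact ⟨hq, h⟩

/-- Maximizers in `Q` at points near `x` are close to the unique maximizer at `x`. -/
theorem eventually_maximizer_mem (hQ : IsCompact Q) (hQ' : Q.Nonempty)
    (hd : DifferentiableAt ℝ (supportFn Q) x) {U : Set (Space n)}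
    (hU : U ∈ 𝓝 (gradient (supportFn Q) x)) :
    ∀ᶠ y in 𝓝 x, ∀ q ∈ Q, inner ℝ y q = supportFn Q y → q ∈ U := by
  obtain ⟨V, hVU, hVo, hV⟩ := mem_nhds_iff.1 hU
  have hcont := continuous_supportFn hQ.isBounded hQ'
  have hopen : IsOpen {z : Space n × Space n | inner ℝ z.1 z.2 < supportFn Q z.1} :=
    isOpen_lt (by fun_prop) (by fun_prop)
  -- No point of the compact set `Q \ V` is a maximizer at `x`, since every maximizer equals the
  -- gradient; the tube lemma keeps this strict inequality for all nearby `y`.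
  obtain ⟨A, B, hA, -, hxA, hB, hAB⟩ := generalized_tube_lemma (isCompact_singleton (x := x))
    (hQ.diff hVo) hopen (by
      rintro ⟨a, q⟩ ⟨rfl, hq, hqV⟩
      refine lt_of_le_of_ne (inner_le_supportFn hQ.isBounded hq a) fun h => hqV ?_
      rwa [← gradient_eq_of_inner_le hd (fun y => inner_le_supportFn hQ.isBounded hq y) h])
  filter_upwards [hA.mem_nhds (singleton_subset_iff.1 hxA)] with y hy q hq h
  by_contra hqU
  have : (y, q) ∈ A ×ˢ B := ⟨hy, hB ⟨hq, fun h => hqU (hVU h)⟩⟩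
  exact (hAB this).ne h

/-- The support function of a compact set is strictly differentiable wherever it is
differentiable. -/
theorem eventually_supportFn_sub_le (hQ : IsCompact Q) (hQ' : Q.Nonempty)
    (hd : DifferentiableAt ℝ (supportFn Q) x) {ε : ℝ} (hε : 0 < ε) :
    ∀ᶠ y in 𝓝 x, ∀ z, supportFn Q y - supportFn Q z -
      inner ℝ (y - z) (gradient (supportFn Q) x) ≤ ε * ‖y - z‖ := by
  filter_upwards [eventually_maximizer_mem hQ hQ' hd (Metric.ball_mem_nhds _ hε)] with y hy z
  -- A maximizer `q` at `y` gives the subgradient inequality `h(y) - h(z) ≤ (y - z) ⬝ q` for every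
  -- `z`, and `q` is within `ε` of the gradient at `x`.
  obtain ⟨q, hq, h⟩ := exists_inner_eq_supportFn hQ hQ' y
  have h1 := inner_le_supportFn hQ.isBounded hq z
  have h2 := hy q hq h
  rw [mem_ball_iff_norm] at h2
  have h3 := real_inner_le_norm (y - z) (q - gradient (supportFn Q) x)
  rw [inner_sub_right, inner_sub_left] at h3
  have : ‖y - z‖ * ‖q - gradient (supportFn Q) x‖ ≤ ε * ‖y - z‖ := by
    rw [mul_comm]; gcongr
  linarith

theorem exists_pos_mul_norm_le_supportFn (hQ : Bornology.IsBounded Q) (hQ' : Q.Nonempty)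
    (hpos : ∀ x ≠ 0, 0 < supportFn Q x) : ∃ c > 0, ∀ x, c * ‖x‖ ≤ supportFn Q x := by
  have hcont := continuous_supportFn hQ hQ'
  have h0 : supportFn Q 0 = 0 := by simpa using supportFn_smul Q le_rfl (0 : Space n)
  rcases (Metric.sphere (0 : Space n) 1).eq_empty_or_nonempty with he | hne
  · refine ⟨1, one_pos, fun x => ?_⟩
    have : x = 0 := by
      by_contra hx
      have : ‖x‖⁻¹ • x ∈ Metric.sphere (0 : Space n) 1 := by
        simp [norm_smul, hx]
      simp [he] at this
    simp [this, h0]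
  · obtain ⟨x₀, hx₀, hmin⟩ := (isCompact_sphere (0 : Space n) 1).exists_isMinOn hne
      hcont.continuousOn
    refine ⟨supportFn Q x₀, hpos _ (by rintro rfl; simp at hx₀), fun x => ?_⟩
    rcases eq_or_ne x 0 with rfl | hx
    · simp [h0]
    · have h1 : supportFn Q x₀ ≤ supportFn Q (‖x‖⁻¹ • x) :=
        hmin (by simp [norm_smul, hx])
      rw [supportFn_smul Q (by positivity)] at h1
      have : 0 < ‖x‖ := norm_pos_iff.2 hx
      rwa [inv_mul_eq_div, le_div_iff₀ this] at h1

end SupportFn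

/-! ### Polar coordinates and cones over flat pieces -/

section Polar

open scoped ENNReal Pointwise

/-- The open cone over `A ⊆ S^{n-1}` with radial profile `R`. -/
def coneOver (A : Set (Sph n)) (R : Sph n → ℝ) : Set (Space n) :=
  {x | ∃ ξ ∈ A, ∃ r ∈ Ioo 0 (R ξ), r • (ξ : Space n) = x}

theorem coneOver_eq_image (A : Set (Sph n)) (R : Sph n → ℝ) :
    coneOver A R = (↑) '' (homeomorphUnitSphereProd (Space n) ⁻¹'
      {p | p.1 ∈ A ∧ (p.2 : ℝ) < R p.1}) := by
  rw [← Homeomorph.image_symm, image_image]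
  ext x
  constructor
  · rintro ⟨ξ, hξ, r, hr, rfl⟩
    exact ⟨(ξ, ⟨r, hr.1⟩), ⟨hξ, hr.2⟩, by simp⟩
  · rintro ⟨⟨ξ, r⟩, ⟨hξ, hr⟩, rfl⟩
    exact ⟨ξ, hξ, r, ⟨r.2, hr⟩, by simp⟩

theorem measurableSet_profile {A : Set (Sph n)} (hA : MeasurableSet A) {R : Sph n → ℝ}
    (hR : Measurable R) :
    MeasurableSet {p : Sph n × Ioi (0 : ℝ) | p.1 ∈ A ∧ (p.2 : ℝ) < R p.1} :=
  (measurable_fst hA).inter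
    (measurableSet_lt (measurable_subtype_coe.comp measurable_snd) (hR.comp measurable_fst))

theorem measurableSet_coneOver {A : Set (Sph n)} (hA : MeasurableSet A) {R : Sph n → ℝ}
    (hR : Measurable R) : MeasurableSet (coneOver A R) := by
  rw [coneOver_eq_image]
  exact (MeasurableEmbedding.subtype_coe (measurableSet_singleton _).compl).measurableSet_image.2
    ((homeomorphUnitSphereProd (Space n)).measurable (measurableSet_profile hA hR))

/-- Radial integration of `rⁿ⁻¹` up to `R ξ` gives `R ξ ^ n / n`. Positivity of `R` makes the radial
slice an initial segment of `Ioi 0`. -/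
theorem natCast_mul_volume_coneOver (hn : n ≠ 0) {A : Set (Sph n)} (hA : MeasurableSet A)
    {R : Sph n → ℝ} (hR : Measurable R) (hpos : ∀ ξ ∈ A, 0 < R ξ) :
    n * volume (coneOver A R) = ∫⁻ ξ in A, ENNReal.ofReal (R ξ ^ n) ∂sphMeasure n := by
  have hm := measurableSet_profile hA hR
  have hmp := (volume : Measure (Space n)).measurePreserving_homeomorphUnitSphereProd
  rw [coneOver_eq_image, ← comap_subtype_coe_apply (measurableSet_singleton _).compl,
    hmp.measure_preimage hm.nullMeasurableSet, Measure.prod_apply hm,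
    ← lintegral_const_mul' _ _ (by simp), ← lintegral_indicator hA]
  refine lintegral_congr fun ξ => ?_
  by_cases hξ : ξ ∈ A
  · have : Prod.mk ξ ⁻¹' {p : Sph n × Ioi (0 : ℝ) | p.1 ∈ A ∧ (p.2 : ℝ) < R p.1} =
        Iio ⟨R ξ, hpos ξ hξ⟩ := by
      ext r
      simp [hξ, ← Subtype.coe_lt_coe]
    rw [this, Measure.volumeIoiPow_apply_Iio, indicator_of_mem hξ, ← ENNReal.ofReal_natCast,
      ← ENNReal.ofReal_mul (by positivity)]
    have h1 : Module.finrank ℝ (Space n) = n := by simp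
    rw [h1, Nat.sub_add_cancel (Nat.one_le_iff_ne_zero.2 hn)]
    congr 1
    have : ((n - 1 : ℕ) : ℝ) + 1 = n := by
      exact_mod_cast Nat.sub_add_cancel (Nat.one_le_iff_ne_zero.2 hn)
    rw [this, mul_div_cancel₀]
    exact_mod_cast hn
  · simp [hξ]

/-- The radial image of the sphere on the level set `{G = 1}` of a positively homogeneous
function. -/
def levelMap (G : Space n → ℝ) (ξ : Sph n) : Space n := (G ξ)⁻¹ • (ξ : Space n)

/-- The cone ends at the hyperplane `x ⬝ q = 1`, so its parallel slices are homothetic copies of the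
base. This makes its volume computable by slicing. -/
theorem coneOver_inter_level {q : Space n} {A : Set (Sph n)}
    (hA : ∀ ξ ∈ A, 0 < inner ℝ (ξ : Space n) q) (s : ℝ) :
    coneOver A (fun ξ => (inner ℝ (ξ : Space n) q)⁻¹) ∩ {x | inner ℝ x q = s} =
      if s ∈ Ioo (0 : ℝ) 1 then s • levelMap (fun x => inner ℝ x q) '' A else ∅ := by
  split_ifs with hs
  · ext x
    constructor
    · rintro ⟨⟨ξ, hξ, r, hr, rfl⟩, h⟩
      have h0 := hA ξ hξ
      refine ⟨_, mem_image_of_mem _ hξ, ?_⟩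
      simp only [mem_ofPred_eq, inner_smul_left, conj_trivial] at h
      simp only [levelMap, smul_smul, ← h]
      rw [mul_inv_cancel_right₀ h0.ne']
    · rintro ⟨_, ⟨ξ, hξ, rfl⟩, rfl⟩
      have h0 := hA ξ hξ
      refine ⟨⟨ξ, hξ, s * (inner ℝ (ξ : Space n) q)⁻¹, ⟨by have := hs.1; positivity, ?_⟩, ?_⟩, ?_⟩
      · exact mul_lt_of_lt_one_left (by positivity) hs.2
      · simp [levelMap, smul_smul]
      · simp [levelMap, inner_smul_left, h0.ne']
  · rw [eq_empty_iff_forall_notMem]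
    rintro _ ⟨⟨ξ, hξ, r, hr, rfl⟩, h⟩
    have h0 := hA ξ hξ
    simp only [mem_ofPred_eq, inner_smul_left, conj_trivial] at h
    refine hs ⟨by rw [← h]; exact mul_pos hr.1 h0, ?_⟩
    rw [← h]
    exact (lt_div_iff₀ h0).1 (by simpa using hr.2)

/-- The volume of a cone over a piece of a hyperplane, in polar coordinates. -/
theorem lintegral_inner_inv_pow (hn : n ≠ 0) {q : Space n} (hq : q ≠ 0) {A : Set (Sph n)}
    (hA : MeasurableSet A) (hpos : ∀ ξ ∈ A, 0 < inner ℝ (ξ : Space n) q) :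
    ∫⁻ ξ in A, ENNReal.ofReal ((inner ℝ (ξ : Space n) q)⁻¹ ^ n * ‖q‖) ∂sphMeasure n =
      Measure.euclideanHausdorffMeasure (n - 1) (levelMap (fun x => inner ℝ x q) '' A) := by
  have hq0 : 0 < ‖q‖ := norm_pos_iff.2 hq
  set m := Measure.euclideanHausdorffMeasure (n - 1) (levelMap (fun x => inner ℝ x q) '' A)
  have hmeas : Measurable fun ξ : Sph n => (inner ℝ (ξ : Space n) q)⁻¹ := by fun_prop
  have h1 := natCast_mul_volume_coneOver hn hA hmeas fun ξ hξ => inv_pos.2 (hpos ξ hξ)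
  have h2 := EuclideanGeometry.euclideanHausdorffMeasure_eq_lintegral (0 : Space n) hq
    (measurableSet_coneOver hA hmeas)
  rw [InnerProductSpace.euclideanHausdorffMeasure_eq_volume] at h2
  have hfr : Module.finrank ℝ (Space n) = n := by simp
  have hc : 0 < ‖q‖ ^ 2 := by positivity
  -- The slicing direction `q` is not normalized, which accounts for the factor `‖q‖ ^ 2`.
  have hslice (t : ℝ) : ((AffineSubspace.mk' (t • q +ᵥ (0 : Space n)) (ℝ ∙ q)ᗮ : AffineSubspace ℝ _)
      : Set (Space n)) = {x | inner ℝ x q = t * ‖q‖ ^ 2} := by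
    ext x
    rw [SetLike.mem_coe, AffineSubspace.mem_mk', Submodule.mem_orthogonal_singleton_iff_inner_left]
    simp [inner_sub_left, inner_smul_left, sub_eq_zero]
  have hint (t : ℝ) : Measure.euclideanHausdorffMeasure (n - 1)
      (coneOver A (fun ξ => (inner ℝ (ξ : Space n) q)⁻¹) ∩ {x | inner ℝ x q = t * ‖q‖ ^ 2}) =
      (Ioo 0 (‖q‖ ^ 2)⁻¹).indicator
        (fun t => ENNReal.ofReal ((t * ‖q‖ ^ 2) ^ (n - 1))) t * m := by
    rw [coneOver_inter_level hpos]
    have hiff : t * ‖q‖ ^ 2 ∈ Ioo (0 : ℝ) 1 ↔ t ∈ Ioo 0 (‖q‖ ^ 2)⁻¹ := by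
      simp only [mem_Ioo, mul_pos_iff_of_pos_right hc, ← one_div, lt_div_iff₀ hc]
    split_ifs with hs
    · rw [indicator_of_mem (hiff.1 hs), Measure.euclideanHausdorffMeasure_smul₀ _ hs.1.ne']
      rw [ENNReal.smul_def, smul_eq_mul]
      congr 1
      rw [← Real.enorm_eq_ofReal (pow_nonneg hs.1.le _), enorm_pow]
      simp [enorm]
    · rw [indicator_of_notMem (fun h => hs (hiff.2 h))]
      simp
  simp_rw [hfr, hslice, hint] at h2
  have hval : ∫⁻ t : ℝ, (Ioo 0 (‖q‖ ^ 2)⁻¹).indicator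
        (fun t => ENNReal.ofReal ((t * ‖q‖ ^ 2) ^ (n - 1))) t =
      ENNReal.ofReal ((n * ‖q‖ ^ 2)⁻¹) := by
    have hle : (0 : ℝ) ≤ (‖q‖ ^ 2)⁻¹ := by positivity
    have hn' : ((n - 1 : ℕ) : ℝ) + 1 = n := by
      exact_mod_cast Nat.sub_add_cancel (Nat.one_le_iff_ne_zero.2 hn)
    have hint : IntervalIntegrable (fun t : ℝ => (t * ‖q‖ ^ 2) ^ (n - 1)) volume 0
      (‖q‖ ^ 2)⁻¹ := (by fun_prop : Continuous _).intervalIntegrable _ _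
    rw [lintegral_indicator measurableSet_Ioo, Measure.restrict_congr_set Ioo_ae_eq_Ioc,
      ← ofReal_integral_eq_lintegral_ofReal hint.1, ← intervalIntegral.integral_of_le hle,
      intervalIntegral.integral_comp_mul_right (fun t => t ^ (n - 1)) hc.ne', integral_pow, hn',
      Nat.sub_add_cancel (Nat.one_le_iff_ne_zero.2 hn)]
    · congr 1
      simp [hc.ne', hn]
    · filter_upwards [ae_restrict_mem measurableSet_Ioc] with t ht
      exact pow_nonneg (mul_nonneg ht.1.le hc.le) _
  rw [lintegral_mul_const _ (by
    refine Measurable.indicator ?_ measurableSet_Ioo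
    fun_prop), hval] at h2
  rw [h2] at h1
  have h3 (ξ : Sph n) : ENNReal.ofReal ((inner ℝ (ξ : Space n) q)⁻¹ ^ n * ‖q‖) =
      ENNReal.ofReal ((inner ℝ (ξ : Space n) q)⁻¹ ^ n) * ENNReal.ofReal ‖q‖ :=
    ENNReal.ofReal_mul' hq0.le
  simp_rw [h3]
  rw [lintegral_mul_const' _ _ (by simp), ← h1, ← ofReal_norm]
  rw [← ENNReal.ofReal_natCast, ← mul_assoc (ENNReal.ofReal ‖q‖), ← mul_assoc, mul_right_comm,
    ← ENNReal.ofReal_mul (by positivity), ← ENNReal.ofReal_mul (by positivity),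
    ← ENNReal.ofReal_mul (by positivity)]
  have : (n : ℝ) * (‖q‖ * (n * ‖q‖ ^ 2)⁻¹) * ‖q‖ = 1 := by
    have : (n : ℝ) ≠ 0 := by exact_mod_cast hn
    field_simp
  rw [this]
  simp

end Polar

/-! ### Lipschitz comparison of radial graphs -/

section Area

open scoped ENNReal NNReal

/-- The constant tends to 1 as `a → 1` and `ε → 0`, so rescaling is almost non-expanding where `M`
is close to 1 and nearly constant. -/
theorem lipschitzOnWith_inv_smul {B : Set (Space n)} {M : Space n → ℝ} {a R ε : ℝ≥0}
    (ha : 0 < a) (hR : ∀ y ∈ B, ‖y‖ ≤ R) (hM : ∀ y ∈ B, a ≤ M y)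
    (hlip : ∀ y ∈ B, ∀ z ∈ B, |M y - M z| ≤ ε * ‖y - z‖) :
    LipschitzOnWith (a⁻¹ + R * ε * (a⁻¹ * a⁻¹)) (fun y => (M y)⁻¹ • y) B := by
  refine LipschitzOnWith.of_dist_le_mul fun y hy z hz => ?_
  have ha' : (0 : ℝ) < a := by exact_mod_cast ha
  have hy0 : 0 < M y := ha'.trans_le (hM y hy)
  have hz0 : 0 < M z := ha'.trans_le (hM z hz)
  have hdec : (M y)⁻¹ • y - (M z)⁻¹ • z =
      (M y)⁻¹ • (y - z) + ((M z - M y) * ((M y)⁻¹ * (M z)⁻¹)) • z := by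
    have : (M z - M y) * ((M y)⁻¹ * (M z)⁻¹) = (M y)⁻¹ - (M z)⁻¹ := by field_simp
    rw [this, smul_sub, sub_smul]
    abel
  rw [dist_eq_norm, dist_eq_norm, hdec]
  refine (norm_add_le _ _).trans ?_
  rw [norm_smul, norm_smul, norm_mul, norm_mul, Real.norm_of_nonneg (inv_nonneg.2 hy0.le),
    Real.norm_of_nonneg (inv_nonneg.2 hz0.le), Real.norm_eq_abs, abs_sub_comm]
  have h1 : (M y)⁻¹ ≤ (a : ℝ)⁻¹ := inv_anti₀ ha' (hM y hy)
  have h2 : (M z)⁻¹ ≤ (a : ℝ)⁻¹ := inv_anti₀ ha' (hM z hz)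
  have h3 := hlip y hy z hz
  have h4 := hR z hz
  calc (M y)⁻¹ * ‖y - z‖ + |M y - M z| * ((M y)⁻¹ * (M z)⁻¹) * ‖z‖
      ≤ (a : ℝ)⁻¹ * ‖y - z‖ + ε * ‖y - z‖ * ((a : ℝ)⁻¹ * (a : ℝ)⁻¹) * R := by gcongr
    _ = _ := by push_cast; ring

theorem _root_.LipschitzOnWith.euclideanHausdorffMeasure_image_le {X Y : Type*}
    [EMetricSpace X] [MeasurableSpace X] [BorelSpace X]
    [EMetricSpace Y] [MeasurableSpace Y] [BorelSpace Y] {K : ℝ≥0} {f : X → Y} {s : Set X}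
    (h : LipschitzOnWith K f s) (d : ℕ) :
    Measure.euclideanHausdorffMeasure d (f '' s) ≤
      (K : ℝ≥0∞) ^ d * Measure.euclideanHausdorffMeasure d s := by
  have := h.hausdorffMeasure_image_le (d := d) (by positivity)
  rw [ENNReal.rpow_natCast] at this
  rw [Measure.euclideanHausdorffMeasure_def, Measure.euclideanHausdorffMeasure_def,
    Measure.smul_apply, Measure.smul_apply, ENNReal.smul_def, ENNReal.smul_def, smul_eq_mul,
    smul_eq_mul, mul_left_comm]
  gcongr

theorem inv_smul_levelMap {M N : Space n → ℝ} (hM : ∀ c : ℝ, 0 ≤ c → ∀ x, M (c • x) = c * M x)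
    {ξ : Sph n} (hN : 0 < N ξ) :
    (M (levelMap N ξ))⁻¹ • levelMap N ξ = levelMap M ξ := by
  unfold levelMap
  rw [hM _ (inv_nonneg.2 hN.le), smul_smul, mul_inv, inv_inv, mul_right_comm,
    mul_inv_cancel₀ hN.ne', one_mul]

theorem apply_levelMap {M : Space n → ℝ} (hM : ∀ c : ℝ, 0 ≤ c → ∀ x, M (c • x) = c * M x)
    {ξ : Sph n} (h : 0 < M ξ) : M (levelMap M ξ) = 1 := by
  rw [levelMap, hM _ (inv_nonneg.2 h.le), inv_mul_cancel₀ h.ne']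

/-- Comparison of the Hausdorff measures of two radial graphs over the same set. -/
theorem euclideanHausdorffMeasure_levelMap_le {M N : Space n → ℝ}
    (hM : ∀ c : ℝ, 0 ≤ c → ∀ x, M (c • x) = c * M x) {A : Set (Sph n)} {a R ε : ℝ≥0}
    (hN : ∀ ξ ∈ A, 0 < N ξ) (ha : 0 < a) (hR : ∀ ξ ∈ A, ‖levelMap N ξ‖ ≤ R)
    (hMa : ∀ ξ ∈ A, a ≤ M (levelMap N ξ))
    (hlip : ∀ ξ ∈ A, ∀ η ∈ A, |M (levelMap N ξ) - M (levelMap N η)| ≤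
      ε * ‖levelMap N ξ - levelMap N η‖) (d : ℕ) :
    Measure.euclideanHausdorffMeasure d (levelMap M '' A) ≤
      ((a⁻¹ + R * ε * (a⁻¹ * a⁻¹) : ℝ≥0) : ℝ≥0∞) ^ d *
        Measure.euclideanHausdorffMeasure d (levelMap N '' A) := by
  have himg : levelMap M '' A = (fun y => (M y)⁻¹ • y) '' (levelMap N '' A) := by
    rw [image_image]
    exact image_congr fun ξ hξ => (inv_smul_levelMap hM (hN ξ hξ)).symm
  rw [himg]
  refine LipschitzOnWith.euclideanHausdorffMeasure_image_le
    (lipschitzOnWith_inv_smul ha ?_ ?_ ?_) d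
  · rintro _ ⟨ξ, hξ, rfl⟩
    exact hR ξ hξ
  · rintro _ ⟨ξ, hξ, rfl⟩
    exact hMa ξ hξ
  · rintro _ ⟨ξ, hξ, rfl⟩ _ ⟨η, hη, rfl⟩
    exact hlip ξ hξ η hη

/-- By the Lindelöf property countably many of the neighbourhoods cover `T`; making them disjoint
allows the local inequalities to be summed. -/
theorem measure_le_of_locally_le {X : Type*} [TopologicalSpace X] [SecondCountableTopology X]
    [MeasurableSpace X] [OpensMeasurableSpace X] {μ ν : Measure X} {T : Set X}
    (hT : MeasurableSet T) (hμ : μ Tᶜ = 0) {c : ℝ≥0∞}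
    (h : ∀ x ∈ T, ∃ U ∈ 𝓝 x, ∀ A, MeasurableSet A → A ⊆ U ∩ T → μ A ≤ c * ν A) :
    μ ≤ c • ν := by
  choose! U hU hUA using h
  obtain ⟨t, htT, htc, hcov⟩ := TopologicalSpace.countable_cover_nhdsWithin
    (f := fun x => interior (U x)) (s := T)
    fun x hx => mem_nhdsWithin_of_mem_nhds (interior_mem_nhds.2 (hU x hx))
  refine Measure.le_iff.2 fun A hA => ?_
  rcases t.eq_empty_or_nonempty with rfl | hne
  · have hTe : T = ∅ := by simpa using hcov
    have : μ A = 0 := measure_mono_null (subset_univ A) (by simpa [hTe] using hμ)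
    simp [this]
  obtain ⟨x, hx⟩ := htc.exists_eq_range hne
  have hxT (k : ℕ) : x k ∈ T := htT (hx ▸ mem_range_self k)
  set B : ℕ → Set X := disjointed fun k => interior (U (x k))
  have hBm (k : ℕ) : MeasurableSet (B k) :=
    MeasurableSet.disjointed (fun _ => isOpen_interior.measurableSet) k
  have hBU : T ⊆ ⋃ k, B k := by
    rw [iUnion_disjointed]
    refine hcov.trans ?_
    rw [hx, biUnion_range]
  have hAT : A ∩ T = ⋃ k, A ∩ T ∩ B k := by
    rw [← inter_iUnion, inter_eq_left.2 (inter_subset_right.trans hBU)]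
  have hdisj : Pairwise (Function.onFun Disjoint fun k => A ∩ T ∩ B k) := fun i j hij =>
    (disjoint_disjointed (fun k => interior (U (x k))) hij).mono inter_subset_right
      inter_subset_right
  calc μ A = μ (A ∩ T) := by
        refine (measure_inter_conull' (measure_mono_null ?_ hμ)).symm
        exact fun y hy => hy.2
    _ = ∑' k, μ (A ∩ T ∩ B k) := by
        conv_lhs => rw [hAT]
        exact measure_iUnion hdisj fun k => (hA.inter hT).inter (hBm k)
    _ ≤ ∑' k, c * ν (A ∩ T ∩ B k) := by
        refine ENNReal.tsum_le_tsum fun k => hUA _ (hxT k) _ ((hA.inter hT).inter (hBm k)) ?_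
        exact fun y hy => ⟨interior_subset (disjointed_subset (fun k => interior (U (x k))) k hy.2), hy.1.2⟩
    _ = c * ν (A ∩ T) := by
        rw [ENNReal.tsum_mul_left, ← measure_iUnion hdisj fun k => (hA.inter hT).inter (hBm k),
          ← hAT]
    _ ≤ (c • ν) A := by
        rw [Measure.smul_apply, smul_eq_mul]
        gcongr
        exact inter_subset_left

variable {Q : Set (Space n)}

theorem supportFn_sph_pos (hpos : ∀ x ≠ 0, 0 < supportFn Q x) (ξ : Sph n) : 0 < supportFn Q ξ :=
  hpos _ fun h => by simpa [h] using ξ.2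

theorem differentiableAt_of_smul {r : ℝ} (hr : 0 < r) {x : Space n}
    (h : DifferentiableAt ℝ (supportFn Q) (r • x)) : DifferentiableAt ℝ (supportFn Q) x := by
  have h1 : supportFn Q = fun y => r⁻¹ * supportFn Q (r • y) := by
    ext y
    rw [supportFn_smul Q hr.le, inv_mul_cancel_left₀ hr.ne']
  rw [h1]
  exact (h.comp x (by fun_prop : DifferentiableAt ℝ (fun y : Space n => r • y) x)).const_mul _

theorem measurableSet_differentiableAt (Q : Set (Space n)) :
    MeasurableSet {ξ : Sph n | DifferentiableAt ℝ (supportFn Q) ξ} :=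
  measurable_subtype_coe (measurableSet_of_differentiableAt ℝ (supportFn Q))

/-- Rademacher's theorem gives a null set in space. By homogeneity non-differentiability at `ξ`
persists along its whole ray, so the directions concerned span a null cone and form a null set on
the sphere. -/
theorem ae_differentiableAt_supportFn (hn : n ≠ 0) (hQ : Bornology.IsBounded Q)
    (hQ' : Q.Nonempty) :
    ∀ᵐ ξ : Sph n ∂sphMeasure n, DifferentiableAt ℝ (supportFn Q) (ξ : Space n) := by
  obtain ⟨C, hC⟩ := exists_lipschitzWith_supportFn hQ hQ'
  have h1 := hC.ae_differentiableAt (μ := (volume : Measure (Space n)))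
  have h2 := natCast_mul_volume_coneOver hn (measurableSet_differentiableAt Q).compl
    (R := fun _ => 1) measurable_const (fun _ _ => one_pos)
  have h3 : volume (coneOver {ξ : Sph n | DifferentiableAt ℝ (supportFn Q) ξ}ᶜ
      fun _ => 1) = 0 := by
    refine measure_mono_null ?_ (ae_iff.1 h1)
    rintro _ ⟨ξ, hξ, r, hr, rfl⟩ hd
    exact hξ (differentiableAt_of_smul hr.1 hd)
  rw [h3] at h2
  rw [ae_iff]
  simpa [compl_ofPred] using h2.symm

theorem continuous_levelMap_supportFn (hQ : Bornology.IsBounded Q) (hQ' : Q.Nonempty)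
    (hpos : ∀ x ≠ 0, 0 < supportFn Q x) : Continuous (levelMap (supportFn Q) : Sph n → Space n) :=
  (((continuous_supportFn hQ hQ').comp continuous_subtype_val).inv₀
    fun ξ => (supportFn_sph_pos hpos ξ).ne').smul continuous_subtype_val

theorem levelMap_injective {G : Space n → ℝ} (hG : ∀ ξ : Sph n, 0 < G ξ) :
    Function.Injective (levelMap G : Sph n → Space n) := by
  intro ξ η h
  have h1 := congrArg norm h
  have hξ := hG ξ
  have hη := hG η
  simp only [levelMap, norm_smul, norm_inv, Real.norm_eq_abs, abs_of_pos hξ, abs_of_pos hη,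
    norm_eq_of_mem_sphere, mul_one, inv_inj] at h1
  simp only [levelMap, h1] at h
  exact Subtype.ext (smul_right_injective _ (inv_ne_zero hη.ne') h)

theorem measurableEmbedding_levelMap (hQ : Bornology.IsBounded Q) (hQ' : Q.Nonempty)
    (hpos : ∀ x ≠ 0, 0 < supportFn Q x) :
    MeasurableEmbedding (levelMap (supportFn Q) : Sph n → Space n) :=
  ((continuous_levelMap_supportFn hQ hQ' hpos).isClosedEmbedding
    (levelMap_injective (supportFn_sph_pos hpos))).measurableEmbedding

end Area

/-! ### The area formula for the radial map -/

section AreaFormula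

open scoped ENNReal NNReal

variable {Q : Set (Space n)}

theorem gradient_supportFn_ne_zero (hQ : IsCompact Q) (hQ' : Q.Nonempty)
    (hpos : ∀ x ≠ 0, 0 < supportFn Q x) {ξ : Sph n}
    (hd : DifferentiableAt ℝ (supportFn Q) (ξ : Space n)) : gradient (supportFn Q) ξ ≠ 0 := by
  intro h
  have h1 := (inner_gradient_supportFn hQ hQ' hd).2
  have h2 := supportFn_sph_pos hpos ξ
  rw [← h1, h, inner_zero_right] at h2
  exact h2.false

/-- Radial graphs over sets of measure zero have vanishing Hausdorff measure. -/
theorem euclideanHausdorffMeasure_comap_absolutelyContinuous (hn : n ≠ 0)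
    (hQ : Bornology.IsBounded Q) (hQ' : Q.Nonempty) (hpos : ∀ x ≠ 0, 0 < supportFn Q x) :
    (Measure.euclideanHausdorffMeasure (n - 1)).comap (levelMap (supportFn Q) : Sph n → Space n) ≪
      sphMeasure n := by
  refine Measure.AbsolutelyContinuous.mk fun A hA h0 => ?_
  obtain ⟨C, hC⟩ := exists_lipschitzWith_supportFn hQ hQ'
  obtain ⟨c, hc, hcG⟩ := exists_pos_mul_norm_le_supportFn hQ hQ' hpos
  refine measure_null_of_locally_null _ fun ξ₀ _ => ?_
  set U : Set (Sph n) := {ξ | 1 / 2 < inner ℝ (ξ : Space n) (ξ₀ : Space n)}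
  have hUo : IsOpen U := isOpen_lt continuous_const (by fun_prop)
  have hξ₀ : ξ₀ ∈ U := by
    simp [U]
    norm_num
  refine ⟨A ∩ U, inter_mem self_mem_nhdsWithin
    (mem_nhdsWithin_of_mem_nhds (hUo.mem_nhds hξ₀)), ?_⟩
  have hpU : ∀ ξ ∈ A ∩ U, 0 < inner ℝ (ξ : Space n) (ξ₀ : Space n) := fun ξ hξ => by
    have := hξ.2
    simp only [U, mem_ofPred_eq] at this
    linarith
  have hnorm : ∀ ξ ∈ A ∩ U, ‖levelMap (fun x => inner ℝ x (ξ₀ : Space n)) ξ‖ =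
      (inner ℝ (ξ : Space n) (ξ₀ : Space n))⁻¹ := fun ξ hξ => by
    rw [levelMap, norm_smul, norm_eq_of_mem_sphere, mul_one,
      Real.norm_of_nonneg (inv_nonneg.2 (hpU ξ hξ).le)]
  rw [(measurableEmbedding_levelMap hQ hQ' hpos).comap_apply]
  -- The comparison surface is the hyperplane tangent to the sphere at `ξ₀`. Points of it over `U`
  -- have norm between 1 and 2, and the global Lipschitz constant of the support function serves as
  -- `ε`: a finite factor suffices for null sets.
  have hcomp := euclideanHausdorffMeasure_levelMap_le (M := supportFn Q)
    (N := fun x => inner ℝ x (ξ₀ : Space n)) (A := A ∩ U) (a := ⟨c, hc.le⟩) (R := 2) (ε := C)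
    (fun c hc x => supportFn_smul Q hc x) hpU hc ?_ ?_ ?_ (n - 1)
  · rw [← lintegral_inner_inv_pow hn (ne_zero_of_mem_unit_sphere ξ₀) (hA.inter hUo.measurableSet)
      hpU, setLIntegral_measure_zero _ _ (measure_mono_null inter_subset_left h0), mul_zero] at hcomp
    exact le_antisymm hcomp zero_le
  · intro ξ hξ
    rw [hnorm ξ hξ, inv_le_comm₀ (hpU ξ hξ) (by norm_num)]
    have := hξ.2
    simp only [U, mem_ofPred_eq, one_div] at this
    exact this.le
  · intro ξ hξ
    refine le_trans ?_ (hcG _)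
    rw [hnorm ξ hξ]
    refine le_mul_of_one_le_right hc.le ((one_le_inv₀ (hpU ξ hξ)).2 ?_)
    exact (real_inner_le_norm _ _).trans (by simp)
  · intro ξ _ η _
    simpa [dist_eq_norm] using hC.dist_le_mul _ _

/-- The expression is continuous at `ε = 0` with value 1. It makes the Lipschitz constant of the
graph comparison as close to 1 as desired. -/
theorem exists_pos_pow_le (R : ℝ≥0) (d : ℕ) {c : ℝ≥0} (hc : 1 < c) :
    ∃ ε : ℝ≥0, 0 < ε ∧ ε < 1 ∧
      ((1 - ε)⁻¹ + R * ε * ((1 - ε)⁻¹ * (1 - ε)⁻¹)) ^ d ≤ c := by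
  have h : ContinuousAt
      (fun ε : ℝ≥0 => ((1 - ε)⁻¹ + R * ε * ((1 - ε)⁻¹ * (1 - ε)⁻¹)) ^ d) 0 := by
    have : ContinuousAt (fun ε : ℝ≥0 => (1 - ε)⁻¹) 0 :=
      ContinuousAt.inv₀ (by fun_prop) (by simp)
    fun_prop
  have h1 : ∀ᶠ ε : ℝ≥0 in 𝓝 0,
      ((1 - ε)⁻¹ + R * ε * ((1 - ε)⁻¹ * (1 - ε)⁻¹)) ^ d < c :=
    h.eventually_lt continuousAt_const (by simpa using hc)
  have h2 : ∀ᶠ ε : ℝ≥0 in 𝓝 0, ε < 1 := eventually_lt_nhds one_pos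
  have h3 := ((h1.and h2).filter_mono (nhdsWithin_le_nhds (s := Ioi 0))).and self_mem_nhdsWithin
  obtain ⟨ε, ⟨h1, h2⟩, h3⟩ := h3.exists
  exact ⟨ε, h3, h2, h1.le⟩

/-- Near a point of differentiability, the radial graph of `supportFn Q` is nearly isometric to
its tangent hyperplane. -/
theorem exists_nhds_euclideanHausdorffMeasure_le (hQ : IsCompact Q) (hQ' : Q.Nonempty)
    (hpos : ∀ x ≠ 0, 0 < supportFn Q x) {ξ₀ : Sph n}
    (hd : DifferentiableAt ℝ (supportFn Q) (ξ₀ : Space n)) (d : ℕ) {c : ℝ≥0} (hc : 1 < c) :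
    ∃ U ∈ 𝓝 ξ₀, (∀ ξ ∈ U, 0 < inner ℝ (ξ : Space n) (gradient (supportFn Q) ξ₀)) ∧
      ∀ A ⊆ U,
      Measure.euclideanHausdorffMeasure d (levelMap (supportFn Q) '' A) ≤
        c * Measure.euclideanHausdorffMeasure d
          (levelMap (fun x => inner ℝ x (gradient (supportFn Q) ξ₀)) '' A) ∧
      Measure.euclideanHausdorffMeasure d
          (levelMap (fun x => inner ℝ x (gradient (supportFn Q) ξ₀)) '' A) ≤
        c * Measure.euclideanHausdorffMeasure d (levelMap (supportFn Q) '' A) := by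
  set G := supportFn Q with hG
  set p := gradient G ξ₀ with hp
  set L : Space n → ℝ := fun x => inner ℝ x p with hL
  have hGs : ∀ c : ℝ, 0 ≤ c → ∀ x, G (c • x) = c * G x := fun c hc x => supportFn_smul Q hc x
  have hLs : ∀ c : ℝ, 0 ≤ c → ∀ x, L (c • x) = c * L x := fun c hc x => by
    simp [hL, inner_smul_left]
  have hGc : Continuous G := continuous_supportFn hQ.isBounded hQ'
  have hLc : Continuous L := by fun_prop
  have hG0 : 0 < G ξ₀ := supportFn_sph_pos hpos ξ₀
  have hLG : L ξ₀ = G ξ₀ := (inner_gradient_supportFn hQ hQ' hd).2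
  set x₀ : Space n := levelMap G ξ₀ with hx₀
  have hx₀L : levelMap L ξ₀ = x₀ := by simp only [levelMap, hLG, hx₀]
  have hGx₀ : G x₀ = 1 := apply_levelMap hGs hG0
  have hLx₀ : L x₀ = 1 := by rw [← hx₀L]; exact apply_levelMap hLs (hLG ▸ hG0)
  obtain ⟨ε, hε, hε1, hεc⟩ := exists_pos_pow_le (‖x₀‖₊ + 1) d hc
  have hεR : (0 : ℝ) < ε := hε
  -- The first condition controls `G - L` near `x₀`. On `{L = 1}` the `L` terms cancel, and on `{G =
  -- 1}` the `G` terms do; exchanging `y` and `z` then bounds the variation of the other function by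
  -- `ε ‖y - z‖`.
  set W : Set (Space n) := {y | (∀ z, G y - G z - L (y - z) ≤ ε * ‖y - z‖) ∧
    ‖y‖ < ‖x₀‖ + 1 ∧ 1 - ε < G y ∧ 1 - ε < L y}
  have hW : W ∈ 𝓝 x₀ := by
    refine Filter.inter_mem ?_ (Filter.inter_mem ?_ (Filter.inter_mem ?_ ?_))
    -- The estimate is known near `ξ₀ = G ξ₀ • x₀`; homogeneity transports it to `x₀`.
    · have htend : Tendsto (fun y : Space n => G ξ₀ • y) (𝓝 x₀) (𝓝 (ξ₀ : Space n)) := by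
        have : (ξ₀ : Space n) = G ξ₀ • x₀ := by
          simp [hx₀, levelMap, smul_smul, hG0.ne']
        conv_rhs => rw [this]
        exact (continuous_const_smul _).tendsto x₀
      filter_upwards [htend.eventually (eventually_supportFn_sub_le hQ hQ' hd hεR)] with y hy z
      have h1 := hy (G ξ₀ • z)
      rw [← hG, ← smul_sub, hGs _ hG0.le, hGs _ hG0.le, inner_smul_left, norm_smul,
        Real.norm_of_nonneg hG0.le, conj_trivial] at h1
      refine le_of_mul_le_mul_left ?_ hG0
      simp only [hL]
      linarith
    · exact (isOpen_lt continuous_norm continuous_const).mem_nhds (by simp)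
    · exact (isOpen_lt continuous_const hGc).mem_nhds (by simp [hGx₀, hε])
    · exact (isOpen_lt continuous_const hLc).mem_nhds (by simp [hLx₀, hε])
  have hcGm : ContinuousAt (levelMap G : Sph n → Space n) ξ₀ :=
    (continuous_levelMap_supportFn hQ.isBounded hQ' hpos).continuousAt
  have hcLm : ContinuousAt (levelMap L : Sph n → Space n) ξ₀ :=
    ContinuousAt.smul (ContinuousAt.inv₀ (hLc.comp continuous_subtype_val).continuousAt
      (by simp only [Function.comp]; rw [hLG]; exact hG0.ne')) continuous_subtype_val.continuousAt
  refine ⟨{ξ | levelMap G ξ ∈ W ∧ levelMap L ξ ∈ W ∧ 0 < L ξ}, ?_, fun ξ hξ => hξ.2.2,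
    fun A hA => ⟨?_, ?_⟩⟩
  · refine Filter.inter_mem (hcGm hW) (Filter.inter_mem (hcLm (by rwa [hx₀L])) ?_)
    exact (isOpen_lt continuous_const (hLc.comp continuous_subtype_val)).mem_nhds
      (by simp only [Function.comp]; rw [mem_ofPred_eq, hLG]; exact hG0)
  · refine (euclideanHausdorffMeasure_levelMap_le (M := G) (N := L) (a := 1 - ε) (R := ‖x₀‖₊ + 1)
      (ε := ε) hGs (fun ξ hξ => (hA hξ).2.2) (by simpa using hε1) ?_ ?_ ?_ d).trans ?_
    · intro ξ hξ
      simpa using (hA hξ).2.1.2.1.le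
    · intro ξ hξ
      simpa [NNReal.coe_sub hε1.le] using (hA hξ).2.1.2.2.1.le
    · intro ξ hξ η hη
      have h1 := (hA hξ).2.1.1 (levelMap L η)
      have h2 := (hA hη).2.1.1 (levelMap L ξ)
      rw [norm_sub_rev] at h2
      have h3 (a b : Space n) : L (a - b) = L a - L b := inner_sub_left _ _ _
      rw [h3, apply_levelMap hLs (hA hξ).2.2, apply_levelMap hLs (hA hη).2.2] at h1 h2
      rw [abs_le]
      constructor <;> linarith
    · gcongr
      exact_mod_cast hεc
  · refine (euclideanHausdorffMeasure_levelMap_le (M := L) (N := G) (a := 1 - ε) (R := ‖x₀‖₊ + 1)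
      (ε := ε) hLs (fun ξ hξ => supportFn_sph_pos hpos ξ) (by simpa using hε1) ?_ ?_ ?_ d).trans ?_
    · intro ξ hξ
      simpa using (hA hξ).1.2.1.le
    · intro ξ hξ
      simpa [NNReal.coe_sub hε1.le] using (hA hξ).1.2.2.2.le
    · intro ξ hξ η hη
      have h1 := (hA hξ).1.1 (levelMap G η)
      have h2 := (hA hη).1.1 (levelMap G ξ)
      rw [norm_sub_rev] at h2
      have h3 (a b : Space n) : L (a - b) = L a - L b := inner_sub_left _ _ _
      rw [h3, apply_levelMap hGs (supportFn_sph_pos hpos ξ),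
        apply_levelMap hGs (supportFn_sph_pos hpos η)] at h1 h2
      rw [abs_le]
      constructor <;> linarith
    · gcongr
      exact_mod_cast hεc

/-- Near a point of differentiability, the density of the surface measure is nearly that of the
tangent hyperplane. -/
theorem exists_nhds_density_le (hQ : IsCompact Q) (hQ' : Q.Nonempty)
    (hpos : ∀ x ≠ 0, 0 < supportFn Q x) {ξ₀ : Sph n}
    (hd : DifferentiableAt ℝ (supportFn Q) (ξ₀ : Space n)) {c : ℝ} (hc : 1 < c) :
    ∃ U ∈ 𝓝 ξ₀, ∀ ξ ∈ U, DifferentiableAt ℝ (supportFn Q) (ξ : Space n) →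
      (supportFn Q ξ)⁻¹ ^ n * ‖gradient (supportFn Q) ξ‖ ≤
        c * ((inner ℝ (ξ : Space n) (gradient (supportFn Q) ξ₀))⁻¹ ^ n *
          ‖gradient (supportFn Q) ξ₀‖) ∧
      (inner ℝ (ξ : Space n) (gradient (supportFn Q) ξ₀))⁻¹ ^ n * ‖gradient (supportFn Q) ξ₀‖ ≤
        c * ((supportFn Q ξ)⁻¹ ^ n * ‖gradient (supportFn Q) ξ‖) := by
  set G := supportFn Q with hG
  set p := gradient G ξ₀ with hp
  have hGc : Continuous G := continuous_supportFn hQ.isBounded hQ'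
  have hG0 : 0 < G ξ₀ := supportFn_sph_pos hpos ξ₀
  have hLG : inner ℝ (ξ₀ : Space n) p = G ξ₀ := (inner_gradient_supportFn hQ hQ' hd).2
  have hp0 : 0 < ‖p‖ := norm_pos_iff.2 (gradient_supportFn_ne_zero hQ hQ' hpos hd)
  have ha : ContinuousAt (fun z : Space n × Space n => (G z.1)⁻¹ ^ n * ‖z.2‖) (ξ₀, p) :=
    ((ContinuousAt.inv₀ (f := fun z : Space n × Space n => G z.1)
      (hGc.comp continuous_fst).continuousAt hG0.ne').pow n).mul (by fun_prop)
  have hb : ContinuousAt (fun z : Space n × Space n => (inner ℝ z.1 p)⁻¹ ^ n * ‖p‖) (ξ₀, p) :=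
    ((ContinuousAt.inv₀ (by fun_prop) (by rw [hLG]; exact hG0.ne')).pow n).mul (by fun_prop)
  have hval : 0 < (G ξ₀)⁻¹ ^ n * ‖p‖ := by positivity
  have h1 := ha.eventually_lt (hb.const_mul c) (by
    simp only [hLG]; exact lt_mul_of_one_lt_left hval hc)
  have h2 := hb.eventually_lt (ha.const_mul c) (by
    simp only [hLG]; exact lt_mul_of_one_lt_left hval hc)
  have h3 := h1.and h2
  rw [nhds_prod_eq, eventually_prod_iff] at h3
  obtain ⟨P, hP, R, hR, hPR⟩ := h3
  -- Gradients at nearby points of differentiability are maximizers, hence close to `p`: the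
  -- gradient is continuous at `ξ₀` along such points.
  have h4 := hP.and (eventually_maximizer_mem hQ hQ' hd hR)
  refine ⟨_, continuous_subtype_val.continuousAt h4, fun ξ hξ hdξ => ?_⟩
  obtain ⟨h5, h6⟩ := hξ
  have h7 := inner_gradient_supportFn hQ hQ' hdξ
  have := hPR h5 (h6 _ h7.1 h7.2)
  exact ⟨this.1.le, this.2.le⟩

/-- The area formula for the radial map of a convex body. -/
theorem euclideanHausdorffMeasure_comap_levelMap (hn : n ≠ 0) (hQ : IsCompact Q)
    (hQ' : Q.Nonempty) (hpos : ∀ x ≠ 0, 0 < supportFn Q x) :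
    (Measure.euclideanHausdorffMeasure (n - 1)).comap (levelMap (supportFn Q) : Sph n → Space n) =
      (sphMeasure n).withDensity
        fun ξ => ENNReal.ofReal ((supportFn Q ξ)⁻¹ ^ n * ‖gradient (supportFn Q) ξ‖) := by
  set μ := (Measure.euclideanHausdorffMeasure (n - 1)).comap
    (levelMap (supportFn Q) : Sph n → Space n) with hμ
  set D : Sph n → ℝ≥0∞ :=
    fun ξ => ENNReal.ofReal ((supportFn Q ξ)⁻¹ ^ n * ‖gradient (supportFn Q) ξ‖)
  have hemb := measurableEmbedding_levelMap hQ.isBounded hQ' hpos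
  have hT := measurableSet_differentiableAt Q
  have hT0 : sphMeasure n {ξ : Sph n | DifferentiableAt ℝ (supportFn Q) ξ}ᶜ = 0 :=
    ae_differentiableAt_supportFn hn hQ.isBounded hQ'
  have hμ0 := euclideanHausdorffMeasure_comap_absolutelyContinuous hn hQ.isBounded hQ' hpos hT0
  have hν0 := withDensity_absolutelyContinuous (sphMeasure n) D hT0
  -- One factor `c` compares the graph with its tangent hyperplane, the other compares the two
  -- densities; the hyperplane itself satisfies the formula exactly. In the end `c` decreases to 1.
  have key : ∀ c : ℝ≥0, 1 < c → ∀ ξ₀ ∈ {ξ : Sph n | DifferentiableAt ℝ (supportFn Q) ξ},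
      ∃ U ∈ 𝓝 ξ₀, ∀ A, MeasurableSet A →
        A ⊆ U ∩ {ξ : Sph n | DifferentiableAt ℝ (supportFn Q) ξ} →
        μ A ≤ (c * c : ℝ≥0) * (sphMeasure n).withDensity D A ∧
        (sphMeasure n).withDensity D A ≤ (c * c : ℝ≥0) * μ A := by
    intro c hc ξ₀ hd
    obtain ⟨U, hU, hUpos, hUA⟩ := exists_nhds_euclideanHausdorffMeasure_le hQ hQ' hpos hd (n - 1) hc
    obtain ⟨V, hV, hVA⟩ := exists_nhds_density_le hQ hQ' hpos hd (c := c) (by exact_mod_cast hc)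
    refine ⟨U ∩ V, inter_mem hU hV, fun A hA hAUV => ?_⟩
    obtain ⟨h1, h2⟩ := hUA A fun ξ hξ => (hAUV hξ).1.1
    have h3 := lintegral_inner_inv_pow hn (gradient_supportFn_ne_zero hQ hQ' hpos hd) hA
      fun ξ hξ => hUpos ξ (hAUV hξ).1.1
    rw [← h3, ← hemb.comap_apply] at h1 h2
    rw [withDensity_apply _ hA]
    push_cast
    constructor
    · refine h1.trans ?_
      rw [mul_assoc, ← lintegral_const_mul' (c : ℝ≥0∞) D (by simp)]
      refine mul_le_mul_right ?_ _
      refine setLIntegral_mono' hA fun ξ hξ => ?_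
      refine (ENNReal.ofReal_le_ofReal (hVA ξ (hAUV hξ).1.2 (hAUV hξ).2).2).trans_eq ?_
      rw [ENNReal.ofReal_mul (by positivity), ENNReal.ofReal_coe_nnreal]
    · rw [mul_assoc]
      refine le_trans ?_ (mul_le_mul_right h2 _)
      rw [← lintegral_const_mul' (c : ℝ≥0∞) _ (by simp)]
      refine setLIntegral_mono' hA fun ξ hξ => ?_
      refine (ENNReal.ofReal_le_ofReal (hVA ξ (hAUV hξ).1.2 (hAUV hξ).2).1).trans_eq ?_
      rw [ENNReal.ofReal_mul (by positivity), ENNReal.ofReal_coe_nnreal]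
  have hlim : Tendsto (fun c : ℝ≥0 => c * c) (𝓝[>] 1) (𝓝 1) := by
    have : Continuous fun c : ℝ≥0 => c * c := by fun_prop
    simpa using (this.tendsto 1).mono_left (nhdsWithin_le_nhds (s := Ioi 1))
  have hle : ∀ ν₁ ν₂ : Measure (Sph n), (∀ c : ℝ≥0, 1 < c → ν₁ ≤ ((c * c : ℝ≥0) : ℝ≥0∞) • ν₂) →
      ν₁ ≤ ν₂ := by
    intro ν₁ ν₂ h
    refine Measure.le_iff.2 fun A _ => ?_
    have h1 : Tendsto (fun c : ℝ≥0 => ((c * c : ℝ≥0) : ℝ≥0∞) * ν₂ A) (𝓝[>] 1)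
        (𝓝 (((1 : ℝ≥0) : ℝ≥0∞) * ν₂ A)) :=
      ENNReal.Tendsto.mul_const (ENNReal.tendsto_coe.2 hlim) (by simp)
    rw [ENNReal.coe_one, one_mul] at h1
    refine ge_of_tendsto h1 ?_
    filter_upwards [self_mem_nhdsWithin] with c hc
    exact h c hc A
  refine le_antisymm (hle _ _ fun c hc => ?_) (hle _ _ fun c hc => ?_)
  · refine measure_le_of_locally_le hT hμ0 fun ξ hξ => ?_
    obtain ⟨U, hU, h⟩ := key c hc ξ hξ
    exact ⟨U, hU, fun A hA hAU => (h A hA hAU).1⟩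
  · refine measure_le_of_locally_le hT hν0 fun ξ hξ => ?_
    obtain ⟨U, hU, h⟩ := key c hc ξ hξ
    exact ⟨U, hU, fun A hA hAU => (h A hA hAU).2⟩

end AreaFormula

/-! ### Radial and Gauss maps of a polar body -/

section PolarBody

open scoped ENNReal NNReal

variable {Q : Set (Space n)}

/-- The polar body of `Q`, i.e. the unit ball of the gauge `supportFn Q`. -/
def polarBody (Q : Set (Space n)) : Set (Space n) := {x | supportFn Q x ≤ 1}

theorem supportFn_zero (Q : Set (Space n)) : supportFn Q 0 = 0 := by
  simpa using supportFn_smul Q le_rfl (0 : Space n)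

theorem isCompact_polarBody (hQ : Bornology.IsBounded Q) (hQ' : Q.Nonempty)
    (hpos : ∀ x ≠ 0, 0 < supportFn Q x) : IsCompact (polarBody Q) := by
  obtain ⟨c, hc, h⟩ := exists_pos_mul_norm_le_supportFn hQ hQ' hpos
  refine Metric.isCompact_of_isClosed_isBounded
    (isClosed_le (continuous_supportFn hQ hQ') continuous_const)
    (isBounded_iff_forall_norm_le.2 ⟨c⁻¹, fun x hx => ?_⟩)
  rw [← one_div, le_div_iff₀' hc]
  exact (h x).trans hx

theorem polarBody_nonempty (Q : Set (Space n)) : (polarBody Q).Nonempty :=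
  ⟨0, by simp [polarBody, supportFn_zero]⟩

theorem inv_smul_mem_polarBody {x : Space n} (h : 0 < supportFn Q x) :
    (supportFn Q x)⁻¹ • x ∈ polarBody Q := by
  rw [polarBody, mem_ofPred_eq, supportFn_smul Q (inv_nonneg.2 h.le), inv_mul_cancel₀ h.ne']

theorem radialFn_polarBody {x : Space n} (h : 0 < supportFn Q x) :
    radialFn (polarBody Q) x = (supportFn Q x)⁻¹ := by
  have : {r : ℝ | 0 ≤ r ∧ r • x ∈ polarBody Q} = Icc 0 (supportFn Q x)⁻¹ := by
    ext r
    refine and_congr_right fun hr => ?_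
    rw [polarBody, mem_ofPred_eq, supportFn_smul Q hr, ← le_div_iff₀ h, one_div]
  rw [radialFn, this, csSup_Icc (inv_nonneg.2 h.le)]

theorem radialMap_polarBody (hpos : ∀ x ≠ 0, 0 < supportFn Q x) :
    radialMap (polarBody Q) = levelMap (supportFn Q) := by
  ext1 ξ
  rw [radialMap, radialFn_polarBody (supportFn_sph_pos hpos ξ), levelMap]

theorem frontier_polarBody (hQ : Bornology.IsBounded Q) (hQ' : Q.Nonempty) :
    frontier (polarBody Q) = {x | supportFn Q x = 1} := by
  refine Subset.antisymm
    (frontier_le_subset_eq (continuous_supportFn hQ hQ') continuous_const) fun x hx => ?_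
  refine ⟨subset_closure (le_of_eq hx), fun hi => ?_⟩
  have ht : Tendsto (fun t : ℝ => t • x) (𝓝[>] 1) (𝓝 x) := by
    have : Continuous fun t : ℝ => t • x := by fun_prop
    simpa using (this.tendsto 1).mono_left (nhdsWithin_le_nhds (s := Ioi 1))
  have h1 := (ht.eventually (mem_interior_iff_mem_nhds.1 hi)).and self_mem_nhdsWithin
  obtain ⟨t, h1, h2⟩ := h1.exists
  have h2 : 1 < t := h2
  have h3 : supportFn Q (t • x) ≤ 1 := h1
  rw [supportFn_smul Q (by linarith), hx] at h3
  linarith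

theorem supportFn_polarBody_pos (hQ : Bornology.IsBounded Q) (hQ' : Q.Nonempty)
    (hpos : ∀ x ≠ 0, 0 < supportFn Q x) {u : Space n} (hu : u ≠ 0) :
    0 < supportFn (polarBody Q) u := by
  have h1 := inner_le_supportFn (isCompact_polarBody hQ hQ' hpos).isBounded
    (inv_smul_mem_polarBody (hpos u hu)) u
  refine lt_of_lt_of_le ?_ h1
  rw [inner_smul_right, real_inner_self_eq_norm_sq]
  have := hpos u hu
  have := norm_pos_iff.2 hu
  positivity

theorem levelMap_mem_polarBody (hpos : ∀ x ≠ 0, 0 < supportFn Q x) (ξ : Sph n) :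
    levelMap (supportFn Q) ξ ∈ polarBody Q :=
  inv_smul_mem_polarBody (supportFn_sph_pos hpos ξ)

/-- The gradient lies in `Q`, which gives `≤ 1`; equality is attained at the boundary point of the
polar body in direction `ξ`. -/
theorem supportFn_polarBody_gradient (hQ : IsCompact Q) (hQ' : Q.Nonempty)
    (hpos : ∀ x ≠ 0, 0 < supportFn Q x) {ξ : Sph n}
    (hd : DifferentiableAt ℝ (supportFn Q) (ξ : Space n)) :
    supportFn (polarBody Q) (gradient (supportFn Q) ξ) = 1 := by
  obtain ⟨h1, h2⟩ := inner_gradient_supportFn hQ hQ' hd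
  refine le_antisymm (supportFn_le (polarBody_nonempty Q) fun y hy => ?_) ?_
  · rw [real_inner_comm]
    exact (inner_le_supportFn hQ.isBounded h1 y).trans hy
  · have h3 := inner_le_supportFn (isCompact_polarBody hQ.isBounded hQ' hpos).isBounded
      (levelMap_mem_polarBody hpos ξ) (gradient (supportFn Q) ξ)
    rwa [levelMap, inner_smul_right, real_inner_comm, h2,
      inv_mul_cancel₀ (supportFn_sph_pos hpos ξ).ne'] at h3

open Classical in
/-- The outer unit normal of `polarBody Q` at the boundary point in direction `ξ`. -/
def unitNormal (Q : Set (Space n)) (ξ : Sph n) : Sph n :=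
  -- The default value only makes the map total: under the positivity hypothesis below, the gradient
  -- is nonzero wherever the support function is differentiable.
  if h : gradient (supportFn Q) ξ = 0 then ξ else
    ⟨‖gradient (supportFn Q) ξ‖⁻¹ • gradient (supportFn Q) ξ, by simp [norm_smul, h]⟩

theorem coe_unitNormal {ξ : Sph n} (h : gradient (supportFn Q) ξ ≠ 0) :
    (unitNormal Q ξ : Space n) = ‖gradient (supportFn Q) ξ‖⁻¹ • gradient (supportFn Q) ξ := by
  simp [unitNormal, h]

theorem measurable_gradient (G : Space n → ℝ) : Measurable (gradient G) :=
  (InnerProductSpace.toDual ℝ (Space n)).symm.continuous.measurable.comp (measurable_fderiv ℝ G)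

theorem measurable_unitNormal (Q : Set (Space n)) : Measurable (unitNormal Q) := by
  have hg : Measurable fun ξ : Sph n => gradient (supportFn Q) (ξ : Space n) :=
    (measurable_gradient _).comp measurable_subtype_coe
  rw [← (MeasurableEmbedding.subtype_coe
    (Metric.isClosed_sphere (x := (0 : Space n)) (ε := 1)).measurableSet).measurable_comp_iff]
  classical
  have : (Subtype.val ∘ unitNormal Q : Sph n → Space n) = fun ξ : Sph n =>
      if gradient (supportFn Q) ξ = 0 then (ξ : Space n) else
        ‖gradient (supportFn Q) ξ‖⁻¹ • gradient (supportFn Q) ξ := by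
    ext1 ξ
    by_cases h : gradient (supportFn Q) (ξ : Space n) = 0 <;> simp [unitNormal, h]
  rw [this]
  exact Measurable.ite (hg (measurableSet_singleton 0)) measurable_subtype_coe
    (hg.norm.inv.smul hg)

theorem supportFn_polarBody_unitNormal (hQ : IsCompact Q) (hQ' : Q.Nonempty)
    (hpos : ∀ x ≠ 0, 0 < supportFn Q x) {ξ : Sph n}
    (hd : DifferentiableAt ℝ (supportFn Q) (ξ : Space n)) :
    supportFn (polarBody Q) (unitNormal Q ξ) = ‖gradient (supportFn Q) ξ‖⁻¹ := by
  rw [coe_unitNormal (gradient_supportFn_ne_zero hQ hQ' hpos hd),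
    supportFn_smul _ (by positivity), supportFn_polarBody_gradient hQ hQ' hpos hd, mul_one]

/-- A normal `u` at the boundary point, divided by its support value, is a linear minorant of the
gauge `supportFn Q` touching it at `ξ`, so it must be the gradient. -/
theorem radialGaussImage_polarBody (hQ : IsCompact Q) (hQ' : Q.Nonempty)
    (hpos : ∀ x ≠ 0, 0 < supportFn Q x) {ξ : Sph n}
    (hd : DifferentiableAt ℝ (supportFn Q) (ξ : Space n)) :
    radialGaussImage (polarBody Q) ξ = {unitNormal Q ξ} := by
  have hp0 := gradient_supportFn_ne_zero hQ hQ' hpos hd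
  have hξ := supportFn_sph_pos hpos ξ
  have hK := (isCompact_polarBody hQ.isBounded hQ' hpos).isBounded
  ext u
  rw [radialGaussImage, radialMap_polarBody hpos, gaussMap, mem_ofPred_eq, mem_singleton_iff]
  constructor
  · intro h
    have hu : 0 < supportFn (polarBody Q) (u : Space n) :=
      supportFn_polarBody_pos hQ.isBounded hQ' hpos (ne_zero_of_mem_unit_sphere u)
    have h1 : gradient (supportFn Q) ξ =
        (supportFn (polarBody Q) (u : Space n))⁻¹ • (u : Space n) := by
      refine gradient_eq_of_inner_le hd (fun y => ?_) ?_
      · rcases eq_or_ne y 0 with rfl | hy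
        · simp [supportFn_zero]
        · have h2 := inner_le_supportFn hK (inv_smul_mem_polarBody (hpos y hy)) (u : Space n)
          rw [inner_smul_right, real_inner_comm, inv_mul_le_iff₀ (hpos y hy), mul_comm] at h2
          rwa [inner_smul_right, inv_mul_le_iff₀ hu]
      · rw [levelMap, inner_smul_left, conj_trivial, inv_mul_eq_iff_eq_mul₀ hξ.ne'] at h
        rw [inner_smul_right, h, mul_comm, mul_inv_cancel_right₀ hu.ne']
    refine Subtype.ext ?_
    rw [coe_unitNormal hp0, h1, norm_smul, norm_eq_of_mem_sphere, mul_one, smul_smul,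
      Real.norm_of_nonneg (inv_nonneg.2 hu.le), inv_inv, mul_inv_cancel₀ hu.ne', one_smul]
  · rintro rfl
    rw [supportFn_polarBody_unitNormal hQ hQ' hpos hd, coe_unitNormal hp0, levelMap,
      inner_smul_left, inner_smul_right, (inner_gradient_supportFn hQ hQ' hd).2, conj_trivial,
      mul_left_comm, inv_mul_cancel₀ hξ.ne', mul_one]

theorem radialGaussMap_polarBody (hQ : IsCompact Q) (hQ' : Q.Nonempty)
    (hpos : ∀ x ≠ 0, 0 < supportFn Q x) {ξ : Sph n}
    (hd : DifferentiableAt ℝ (supportFn Q) (ξ : Space n)) :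
    radialGaussMap (polarBody Q) ξ = unitNormal Q ξ := by
  have hs := radialGaussImage_polarBody hQ hQ' hpos hd
  have h : ∃! u, u ∈ radialGaussImage (polarBody Q) ξ := by
    rw [hs]
    exact ⟨_, rfl, fun _ h => h⟩
  rw [radialGaussMap, dif_pos h]
  exact mem_singleton_iff.1 (hs.subset h.choose_spec.1)

theorem mem_revRadialGaussImage_polarBody (hQ : IsCompact Q) (hQ' : Q.Nonempty)
    (hpos : ∀ x ≠ 0, 0 < supportFn Q x) {ξ : Sph n}
    (hd : DifferentiableAt ℝ (supportFn Q) (ξ : Space n)) (ω : Set (Sph n)) :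
    ξ ∈ revRadialGaussImage (polarBody Q) ω ↔ unitNormal Q ξ ∈ ω := by
  have hs := radialGaussImage_polarBody hQ hQ' hpos hd
  rw [revRadialGaussImage, mem_preimage, invGaussImage, mem_ofPred_eq, ← radialGaussImage, hs,
    singleton_inter_nonempty, and_iff_right]
  rw [frontier_polarBody hQ.isBounded hQ', radialMap_polarBody hpos]
  exact apply_levelMap (fun c hc x => supportFn_smul Q hc x) (supportFn_sph_pos hpos ξ)

/-- Every boundary point is reached by the radial map, so the Hausdorff measure of an inverse Gauss
image can be computed on the sphere of directions. -/
theorem levelMap_image_revRadialGaussImage (hQ : Bornology.IsBounded Q) (hQ' : Q.Nonempty)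
    (hpos : ∀ x ≠ 0, 0 < supportFn Q x) (ω : Set (Sph n)) :
    levelMap (supportFn Q) '' revRadialGaussImage (polarBody Q) ω =
      invGaussImage (polarBody Q) ω := by
  rw [revRadialGaussImage, radialMap_polarBody hpos, image_preimage_eq_inter_range,
    inter_eq_left]
  rintro x ⟨hx, -⟩
  rw [frontier_polarBody hQ hQ', mem_ofPred_eq] at hx
  have hx0 : x ≠ 0 := by
    rintro rfl
    simp [supportFn_zero] at hx
  refine ⟨⟨‖x‖⁻¹ • x, by simp [norm_smul, hx0]⟩, ?_⟩
  have : ‖x‖ ≠ 0 := norm_ne_zero_iff.2 hx0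
  simp [levelMap, supportFn_smul Q (inv_nonneg.2 (norm_nonneg x)), hx, smul_smul, this]

/-- The measure on the sphere that corresponds under the radial map to the Hausdorff measure on
the boundary of `polarBody Q`. -/
def radialAreaMeasure (Q : Set (Space n)) : Measure (Sph n) :=
  (sphMeasure n).withDensity
    fun ξ => ENNReal.ofReal ((supportFn Q ξ)⁻¹ ^ n * ‖gradient (supportFn Q) ξ‖)

/-- The surface area measure of `polarBody Q`. -/
def surfaceMeasure (Q : Set (Space n)) : Measure (Sph n) :=
  (radialAreaMeasure Q).map (unitNormal Q)

theorem radialAreaMeasure_absolutelyContinuous (Q : Set (Space n)) :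
    radialAreaMeasure Q ≪ sphMeasure n :=
  withDensity_absolutelyContinuous _ _

/-- Off the null set of non-differentiability the normal is unique. The right-hand side is a
preimage under a Borel map, which supplies the null measurability of the left-hand side for Borel
`ω`. -/
theorem revRadialGaussImage_ae_eq (hn : n ≠ 0) (hQ : IsCompact Q) (hQ' : Q.Nonempty)
    (hpos : ∀ x ≠ 0, 0 < supportFn Q x) (ω : Set (Sph n)) :
    revRadialGaussImage (polarBody Q) ω =ᵐ[sphMeasure n] unitNormal Q ⁻¹' ω := by
  filter_upwards [ae_differentiableAt_supportFn hn hQ.isBounded hQ'] with ξ hd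
  exact propext (mem_revRadialGaussImage_polarBody hQ hQ' hpos hd ω)

theorem isSurfaceAreaMeasure_surfaceMeasure (hn : n ≠ 0) (hQ : IsCompact Q) (hQ' : Q.Nonempty)
    (hpos : ∀ x ≠ 0, 0 < supportFn Q x) :
    IsSurfaceAreaMeasure (polarBody Q) (surfaceMeasure Q) := by
  intro ω hω
  rw [← levelMap_image_revRadialGaussImage hQ.isBounded hQ' hpos,
    ← (measurableEmbedding_levelMap hQ.isBounded hQ' hpos).comap_apply,
    euclideanHausdorffMeasure_comap_levelMap hn hQ hQ' hpos, surfaceMeasure,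
    Measure.map_apply (measurable_unitNormal Q) hω]
  exact (measure_congr ((radialAreaMeasure_absolutelyContinuous Q).ae_le
    (revRadialGaussImage_ae_eq hn hQ hQ' hpos ω))).symm

instance isFiniteMeasure_sphMeasure : IsFiniteMeasure (sphMeasure n) := by
  unfold sphMeasure
  infer_instance

theorem isFiniteMeasure_radialAreaMeasure (hQ : IsCompact Q) (hQ' : Q.Nonempty)
    (hpos : ∀ x ≠ 0, 0 < supportFn Q x) : IsFiniteMeasure (radialAreaMeasure Q) := by
  obtain ⟨c, hc, h⟩ := exists_pos_mul_norm_le_supportFn hQ.isBounded hQ' hpos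
  obtain ⟨R, hR⟩ := hQ.isBounded.exists_norm_le
  refine isFiniteMeasure_withDensity (ne_of_lt (lt_of_le_of_lt (lintegral_mono
    (g := fun _ => ENNReal.ofReal (c⁻¹ ^ n * max R 0)) fun ξ => ENNReal.ofReal_le_ofReal ?_) ?_))
  · have h1 := supportFn_sph_pos hpos ξ
    have h2 := h ξ
    rw [norm_eq_of_mem_sphere, mul_one] at h2
    gcongr
    by_cases hd : DifferentiableAt ℝ (supportFn Q) (ξ : Space n)
    · exact (hR _ (inner_gradient_supportFn hQ hQ' hd).1).trans (le_max_left _ _)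
    -- The gradient is 0 by convention at points of non-differentiability.
    · simp [gradient, fderiv_zero_of_not_differentiableAt hd]
  · rw [lintegral_const]
    exact ENNReal.mul_lt_top ENNReal.ofReal_lt_top (measure_lt_top _ _)

theorem measurable_density (hQ : Bornology.IsBounded Q) (hQ' : Q.Nonempty) :
    Measurable fun ξ : Sph n => (supportFn Q ξ)⁻¹ ^ n * ‖gradient (supportFn Q) ξ‖ := by
  have h1 : Measurable fun ξ : Sph n => supportFn Q ξ :=
    (continuous_supportFn hQ hQ').measurable.comp measurable_subtype_coe
  have h2 : Measurable fun ξ : Sph n => gradient (supportFn Q) (ξ : Space n) :=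
    (measurable_gradient _).comp measurable_subtype_coe
  exact (h1.inv.pow_const n).mul h2.norm

/-- Integration against the surface area measure in radial coordinates. -/
theorem setIntegral_surfaceMeasure (hQ : Bornology.IsBounded Q) (hQ' : Q.Nonempty)
    (hpos : ∀ x ≠ 0, 0 < supportFn Q x) {φ : Sph n → ℝ} (hφ : Measurable φ) {ω : Set (Sph n)}
    (hω : MeasurableSet ω) :
    ∫ u in ω, φ u ∂surfaceMeasure Q = ∫ ξ in unitNormal Q ⁻¹' ω,
      (supportFn Q ξ)⁻¹ ^ n * ‖gradient (supportFn Q) ξ‖ * φ (unitNormal Q ξ) ∂sphMeasure n := by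
  have hN := measurable_unitNormal Q
  rw [surfaceMeasure, setIntegral_map hω hφ.aestronglyMeasurable hN.aemeasurable,
    radialAreaMeasure, setIntegral_withDensity_eq_setIntegral_toReal_smul₀
      (measurable_density hQ hQ').ennreal_ofReal.aemeasurable (by simp) _ (hN hω)]
  refine integral_congr_ae (Eventually.of_forall fun ξ => ?_)
  have := supportFn_sph_pos hpos ξ
  simp only [smul_eq_mul]
  rw [ENNReal.toReal_ofReal (by positivity)]

theorem integrable_surfaceMeasure_iff (hQ : Bornology.IsBounded Q) (hQ' : Q.Nonempty)
    (hpos : ∀ x ≠ 0, 0 < supportFn Q x) {φ : Sph n → ℝ} (hφ : Measurable φ) :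
    Integrable φ (surfaceMeasure Q) ↔ Integrable (fun ξ : Sph n =>
      (supportFn Q ξ)⁻¹ ^ n * ‖gradient (supportFn Q) ξ‖ * φ (unitNormal Q ξ)) (sphMeasure n) := by
  have hN := measurable_unitNormal Q
  rw [surfaceMeasure, integrable_map_measure hφ.aestronglyMeasurable hN.aemeasurable,
    radialAreaMeasure, integrable_withDensity_iff_integrable_smul₀'
      (measurable_density hQ hQ').ennreal_ofReal.aemeasurable (by simp)]
  refine integrable_congr (Eventually.of_forall fun ξ => ?_)
  have := supportFn_sph_pos hpos ξ
  simp only [smul_eq_mul, Function.comp]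
  rw [ENNReal.toReal_ofReal (by positivity)]

end PolarBody

/-! ### Integration against signed measures with a density -/

section SignedIntegral

variable {X : Type*} [MeasurableSpace X] {σ : Measure X} {φ g : X → ℝ} {s : Set X}

/-- For a nonnegative density the signed measure comes from a finite positive measure, which is its
own variation. -/
theorem integrableOn_withDensityᵥ_of_nonneg (hφ : Measurable φ) (hφi : Integrable φ σ)
    (h0 : ∀ x, 0 ≤ φ x) (hs : MeasurableSet s) (hg : IntegrableOn (fun x => g x * φ x) s σ) :
    VectorMeasure.IntegrableOn (σ.withDensityᵥ φ) g s ∧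
      ∫ᵛ x in s, g x ∂<•(σ.withDensityᵥ φ) = ∫ x in s, g x * φ x ∂σ := by
  have hfin : ∫⁻ x, ENNReal.ofReal (φ x) ∂σ ≠ ⊤ := by
    rw [← ofReal_integral_eq_lintegral_ofReal hφi (Eventually.of_forall h0)]
    exact ENNReal.ofReal_ne_top
  have := isFiniteMeasure_withDensity hfin
  have hS : σ.withDensityᵥ φ = (σ.withDensity fun x => ENNReal.ofReal (φ x)).toSignedMeasure := by
    rw [← withDensityᵥ_toReal hφ.ennreal_ofReal.aemeasurable hfin]
    congr
    ext x
    rw [ENNReal.toReal_ofReal (h0 x)]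
  have heq (x : X) : (ENNReal.ofReal (φ x)).toReal • g x = g x * φ x := by
    rw [ENNReal.toReal_ofReal (h0 x), smul_eq_mul, mul_comm]
  constructor
  · rw [hS, VectorMeasure.IntegrableOn, VectorMeasure.restrict_toSignedMeasure hs,
      VectorMeasure.Integrable, Measure.variation_toSignedMeasure, restrict_withDensity hs,
      integrable_withDensity_iff_integrable_smul₀' hφ.ennreal_ofReal.aemeasurable (by simp)]
    simpa only [heq, IntegrableOn] using hg
  · rw [hS, VectorMeasure.setIntegral_toSignedMeasure hs,
      setIntegral_withDensity_eq_setIntegral_toReal_smul₀ hφ.ennreal_ofReal.aemeasurable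
        (by simp) _ hs]
    simp only [heq]

/-- Integration with respect to a signed measure with a density of constant sign. -/
theorem integrableOn_withDensityᵥ (hφ : Measurable φ) (hφi : Integrable φ σ)
    (h0 : (∀ x, 0 ≤ φ x) ∨ ∀ x, φ x ≤ 0) (hs : MeasurableSet s)
    (hg : IntegrableOn (fun x => g x * φ x) s σ) :
    VectorMeasure.IntegrableOn (σ.withDensityᵥ φ) g s ∧
      ∫ᵛ x in s, g x ∂<•(σ.withDensityᵥ φ) = ∫ x in s, g x * φ x ∂σ := by
  rcases h0 with h0 | h0
  · exact integrableOn_withDensityᵥ_of_nonneg hφ hφi h0 hs hg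
  -- Replacing `φ` by `-φ` leaves the variation unchanged and flips the sign of both integrals.
  · have hg' : IntegrableOn (fun x => g x * (-φ) x) s σ := by
      simpa using hg.neg
    obtain ⟨h1, h2⟩ := integrableOn_withDensityᵥ_of_nonneg hφ.neg hφi.neg
      (fun x => by simpa using h0 x) hs hg'
    rw [withDensityᵥ_neg] at h1 h2
    rw [VectorMeasure.IntegrableOn, VectorMeasure.restrict_neg, VectorMeasure.Integrable,
      VectorMeasure.variation_neg] at h1
    rw [VectorMeasure.restrict_neg, VectorMeasure.integral_neg_vectorMeasure] at h2
    refine ⟨h1, ?_⟩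
    rw [← neg_inj, h2, ← integral_neg]
    simp

end SignedIntegral

/-! ### The Musielak-Orlicz surface area measure -/

section MOMeasure

variable {Q : Set (Space n)} {Ψ : Sph n → ℝ → ℝ}

/-- The density of the Musielak-Orlicz surface area measure with respect to the surface area
measure. -/
def moDensity (Ψ : Sph n → ℝ → ℝ) (K : Set (Space n)) (u : Sph n) : ℝ :=
  1 / partialT Ψ u (supportFn K (u : Space n))

theorem isClassC_of_or (hΨ : IsClassCI Ψ ∨ IsClassCd Ψ) : IsClassC Ψ :=
  hΨ.elim And.left And.left

theorem partialT_ne_zero (hΨ : IsClassCI Ψ ∨ IsClassCd Ψ) (ξ : Sph n) {t : ℝ} (ht : 0 < t) :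
    partialT Ψ ξ t ≠ 0 :=
  hΨ.elim (fun h => (h.2 ξ t ht).ne') fun h => (h.2 ξ t ht).ne

theorem continuous_moDensity (hΨ : IsClassCI Ψ ∨ IsClassCd Ψ) (hQ : IsCompact Q)
    (hQ' : Q.Nonempty) (hpos : ∀ x ≠ 0, 0 < supportFn Q x) :
    Continuous (moDensity Ψ (polarBody Q)) := by
  have hK := isCompact_polarBody hQ.isBounded hQ' hpos
  have hh (u : Sph n) : 0 < supportFn (polarBody Q) (u : Space n) :=
    supportFn_polarBody_pos hQ.isBounded hQ' hpos (ne_zero_of_mem_unit_sphere u)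
  have h1 : Continuous fun u : Sph n => supportFn (polarBody Q) (u : Space n) :=
    (continuous_supportFn hK.isBounded (polarBody_nonempty Q)).comp continuous_subtype_val
  have h2 := (isClassC_of_or hΨ).continuousOn_partialT.comp_continuous
    (f := fun u : Sph n => (u, supportFn (polarBody Q) (u : Space n))) (by fun_prop)
    fun u => ⟨mem_univ _, hh u⟩
  exact continuous_const.div h2 fun u => partialT_ne_zero hΨ u (hh u)

theorem moDensity_sign (hΨ : IsClassCI Ψ ∨ IsClassCd Ψ) (hQ : IsCompact Q)
    (hQ' : Q.Nonempty) (hpos : ∀ x ≠ 0, 0 < supportFn Q x) :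
    (∀ u, 0 ≤ moDensity Ψ (polarBody Q) u) ∨ ∀ u, moDensity Ψ (polarBody Q) u ≤ 0 := by
  have hh (u : Sph n) : 0 < supportFn (polarBody Q) (u : Space n) :=
    supportFn_polarBody_pos hQ.isBounded hQ' hpos (ne_zero_of_mem_unit_sphere u)
  refine hΨ.imp (fun h u => ?_) fun h u => ?_
  · exact one_div_nonneg.2 (h.2 u _ (hh u)).le
  · exact one_div_nonpos.2 (h.2 u _ (hh u)).le

theorem isFiniteMeasure_surfaceMeasure (hQ : IsCompact Q) (hQ' : Q.Nonempty)
    (hpos : ∀ x ≠ 0, 0 < supportFn Q x) : IsFiniteMeasure (surfaceMeasure Q) := by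
  have := isFiniteMeasure_radialAreaMeasure hQ hQ' hpos
  unfold surfaceMeasure
  infer_instance

theorem integrable_moDensity (hΨ : IsClassCI Ψ ∨ IsClassCd Ψ) (hQ : IsCompact Q)
    (hQ' : Q.Nonempty) (hpos : ∀ x ≠ 0, 0 < supportFn Q x) :
    Integrable (moDensity Ψ (polarBody Q)) (surfaceMeasure Q) := by
  have := isFiniteMeasure_surfaceMeasure hQ hQ' hpos
  exact (continuous_moDensity hΨ hQ hQ' hpos).integrable_of_hasCompactSupport
    (HasCompactSupport.of_compactSpace _)

/-- The factor `1 / h_K(α_K)` is `‖∇h_Q‖` and `ρ_K` is `1 / h_Q`, so the integrand is the Jacobian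
of the radial map times the density at the normal. -/
theorem moIntegrand_polarBody (hQ : IsCompact Q) (hQ' : Q.Nonempty)
    (hpos : ∀ x ≠ 0, 0 < supportFn Q x) {ξ : Sph n}
    (hd : DifferentiableAt ℝ (supportFn Q) (ξ : Space n)) :
    moIntegrand Ψ (polarBody Q) ξ = (supportFn Q ξ)⁻¹ ^ n * ‖gradient (supportFn Q) ξ‖ *
      moDensity Ψ (polarBody Q) (unitNormal Q ξ) := by
  rw [moIntegrand, radialGaussMap_polarBody hQ hQ' hpos hd, moDensity,
    radialFn_polarBody (supportFn_sph_pos hpos ξ), div_mul_eq_div_div, div_eq_mul_one_div _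
      (partialT _ _ _)]
  congr 1
  rw [supportFn_polarBody_unitNormal hQ hQ' hpos hd, div_inv_eq_mul]

theorem isMOSurfaceAreaMeasure (hn : n ≠ 0) (hΨ : IsClassCI Ψ ∨ IsClassCd Ψ)
    (hQ : IsCompact Q) (hQ' : Q.Nonempty) (hpos : ∀ x ≠ 0, 0 < supportFn Q x) :
    IsMOSurfaceAreaMeasure Ψ (polarBody Q)
      ((surfaceMeasure Q).withDensityᵥ (moDensity Ψ (polarBody Q))) := by
  have hm := (continuous_moDensity hΨ hQ hQ' hpos).measurable
  have hi := integrable_moDensity hΨ hQ hQ' hpos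
  have hae : moIntegrand Ψ (polarBody Q) =ᵐ[sphMeasure n] fun ξ : Sph n =>
      (supportFn Q ξ)⁻¹ ^ n * ‖gradient (supportFn Q) ξ‖ *
        moDensity Ψ (polarBody Q) (unitNormal Q ξ) := by
    filter_upwards [ae_differentiableAt_supportFn hn hQ.isBounded hQ'] with ξ hd
    exact moIntegrand_polarBody hQ hQ' hpos hd
  have hrev := revRadialGaussImage_ae_eq hn hQ hQ' hpos
  refine ⟨?_, fun ω hω => ?_, fun ω hω => ?_⟩
  · rw [integrable_congr hae]
    exact (integrable_surfaceMeasure_iff hQ.isBounded hQ' hpos hm).1 hi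
  · exact (measurable_unitNormal Q hω).nullMeasurableSet.congr (hrev ω).symm
  · rw [withDensityᵥ_apply hi hω, setIntegral_congr_set (hrev ω),
      setIntegral_surfaceMeasure hQ.isBounded hQ' hpos hm hω]
    exact integral_congr_ae (ae_restrict_of_ae hae.symm)

end MOMeasure

/-! ### Musielak-Orlicz addition for small `ε` -/

section MOAdd

theorem eventually_abs_lt_and_ne_zero {δ : ℝ} (hδ : 0 < δ) :
    ∀ᶠ ε : ℝ in 𝓝[≠] 0, |ε| < δ ∧ ε ≠ 0 := by
  refine Filter.Eventually.and (eventually_nhdsWithin_of_eventually_nhds ?_) self_mem_nhdsWithin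
  exact (continuous_abs.tendsto (0 : ℝ)).eventually_lt_const (by simpa using hδ)

variable {Ψ : Sph n → ℝ → ℝ} {Ω : Set (Sph n)} {f g : Sph n → ℝ}

/-- The mean value theorem for endpoints in either order. -/
theorem exists_partialT_mul_eq_sub (hΨ : IsClassC Ψ) (ξ : Sph n) {s t : ℝ} (hs : 0 < s)
    (ht : 0 < t) : ∃ c ∈ uIcc s t, Ψ ξ t - Ψ ξ s = partialT Ψ ξ c * (t - s) := by
  wlog hst : s ≤ t generalizing s t
  · obtain ⟨c, hc, h⟩ := this ht hs (le_of_not_ge hst)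
    exact ⟨c, uIcc_comm t s ▸ hc, by linarith⟩
  rcases hst.eq_or_lt with rfl | hst
  · exact ⟨s, left_mem_uIcc, by simp⟩
  have hd : ∀ x ∈ Icc s t, DifferentiableAt ℝ (Ψ ξ) x := fun x hx =>
    hΨ.differentiableAt ξ x (hs.trans_le hx.1)
  obtain ⟨c, hc, h⟩ := exists_deriv_eq_slope (Ψ ξ) hst
    (fun x hx => (hd x hx).continuousAt.continuousWithinAt)
    fun x hx => (hd x (Ioo_subset_Icc_self hx)).differentiableWithinAt
  refine ⟨c, by rw [uIcc_of_le hst.le]; exact Ioo_subset_Icc_self hc, ?_⟩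
  rw [partialT, h, div_mul_cancel₀ _ (sub_pos.2 hst).ne']

theorem injOn_Ioi (hΨ : IsClassCI Ψ ∨ IsClassCd Ψ) (ξ : Sph n) : InjOn (Ψ ξ) (Ioi 0) := by
  intro s hs t ht h
  obtain ⟨c, hc, h1⟩ := exists_partialT_mul_eq_sub (isClassC_of_or hΨ) ξ hs ht
  have hc0 : 0 < c := (lt_min hs ht).trans_le hc.1
  rw [h, sub_self, eq_comm, mul_eq_zero, or_iff_right (partialT_ne_zero hΨ ξ hc0)] at h1
  linarith

/-- The two alternatives correspond to `Ψ_t > 0` and `Ψ_t < 0`. -/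
theorem uIcc_subset_of_abs_le {a b m : ℝ} (h : (a ≤ -m ∧ m ≤ b) ∨ (m ≤ a ∧ b ≤ -m)) {v : ℝ}
    (hv : |v| ≤ m) : v ∈ uIcc a b := by
  rw [abs_le] at hv
  rw [mem_uIcc]
  rcases h with h | h
  · left; constructor <;> linarith
  · right; constructor <;> linarith

/-- The Musielak-Orlicz addition is well defined for small `ε`, uniformly on `Ω`, and depends on
`ε` in a Lipschitz way. -/
theorem exists_moAdd_spec (hΨ : IsClassCI Ψ ∨ IsClassCd Ψ) (hΩ : IsClosed Ω)
    (hf : ContinuousOn f Ω) (hf' : ∀ ξ ∈ Ω, 0 < f ξ) (hg : ContinuousOn g Ω) :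
    ∃ δ > 0, ∃ a > 0, ∃ C ≥ 0, (∀ ξ ∈ Ω, a ≤ f ξ) ∧ ∀ ε : ℝ, |ε| < δ → ∀ ξ ∈ Ω,
      a ≤ moAdd Ψ f g ε ξ ∧ Ψ ξ (moAdd Ψ f g ε ξ) = Ψ ξ (f ξ) + ε * g ξ ∧
      |moAdd Ψ f g ε ξ - f ξ| ≤ C * |ε| := by
  have hΩc := hΩ.isCompact
  have hC := isClassC_of_or hΨ
  obtain ⟨a, ha, haf⟩ := hΩc.exists_forall_le' hf hf'
  obtain ⟨b, hb⟩ := hΩc.bddAbove_image hf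
  obtain ⟨B, hB⟩ := hΩc.exists_bound_of_continuousOn hg
  have hbf : ∀ ξ ∈ Ω, f ξ ≤ b := fun ξ hξ => hb (mem_image_of_mem _ hξ)
  have hcomp : IsCompact ((univ : Set (Sph n)) ×ˢ Icc (a / 2) (b + a / 2)) :=
    isCompact_univ.prod isCompact_Icc
  obtain ⟨m, hm, hmt⟩ := hcomp.exists_forall_le' (a := 0)
    (hC.continuousOn_partialT.abs.mono
      (prod_mono_right fun t ht => (half_pos ha).trans_le ht.1))
    fun p hp => abs_pos.2 (partialT_ne_zero hΨ _ ((half_pos ha).trans_le hp.2.1))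
  have hm' : ∀ ξ, ∀ t, a / 2 ≤ t → t ≤ b + a / 2 → m ≤ |partialT Ψ ξ t| := fun ξ t h1 h2 =>
    hmt (ξ, t) ⟨mem_univ _, h1, h2⟩
  have hB0 : 0 < max B 1 := lt_max_of_lt_right one_pos
  -- Since `|Ψ_t| ≥ m` on the compact strip, moving `f ξ` by `a / 2` changes `Ψ` by at least `m * (a
  -- / 2)`, while `|ε g| ≤ max B 1 * |ε|`. This fixes `δ`, and dividing by `m` gives the Lipschitz
  -- constant. The maximum with 1 keeps the denominator positive.
  refine ⟨m * (a / 2) / max B 1, by positivity, a / 2, half_pos ha, max B 1 / m, by positivity,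
    fun ξ hξ => by linarith [haf ξ hξ], fun ε hε ξ hξ => ?_⟩
  have hfa := haf ξ hξ
  have hfb := hbf ξ hξ
  have hεg : |ε * g ξ| ≤ max B 1 * |ε| := by
    rw [abs_mul, mul_comm]
    gcongr
    exact (hB ξ hξ).trans (le_max_left _ _)
  have hεg' : |ε * g ξ| ≤ m * (a / 2) := by
    rw [lt_div_iff₀ hB0] at hε
    linarith
  obtain ⟨c₁, hc₁, h₁⟩ := exists_partialT_mul_eq_sub hC ξ (s := f ξ) (t := f ξ - a / 2)
    (by linarith) (by linarith)
  obtain ⟨c₂, hc₂, h₂⟩ := exists_partialT_mul_eq_sub hC ξ (s := f ξ) (t := f ξ + a / 2)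
    (by linarith) (by linarith)
  rw [uIcc_of_ge (by linarith)] at hc₁
  rw [uIcc_of_le (by linarith)] at hc₂
  have hm₁ := hm' ξ c₁ (by linarith [hc₁.1]) (by linarith [hc₁.2])
  have hm₂ := hm' ξ c₂ (by linarith [hc₂.1]) (by linarith [hc₂.2])
  have hc₁0 : 0 < c₁ := by linarith [hc₁.1]
  have hc₂0 : 0 < c₂ := by linarith [hc₂.1]
  have hmem : ε * g ξ ∈ uIcc (Ψ ξ (f ξ - a / 2) - Ψ ξ (f ξ)) (Ψ ξ (f ξ + a / 2) - Ψ ξ (f ξ)) := by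
    refine uIcc_subset_of_abs_le (hΨ.imp (fun h => ?_) fun h => ?_) hεg'
    · rw [abs_of_pos (h.2 ξ _ hc₁0)] at hm₁
      rw [abs_of_pos (h.2 ξ _ hc₂0)] at hm₂
      rw [h₁, h₂]
      constructor <;> nlinarith
    · rw [abs_of_neg (h.2 ξ _ hc₁0)] at hm₁
      rw [abs_of_neg (h.2 ξ _ hc₂0)] at hm₂
      rw [h₁, h₂]
      constructor <;> nlinarith
  have hcont : ContinuousOn (fun t => Ψ ξ t - Ψ ξ (f ξ)) (uIcc (f ξ - a / 2) (f ξ + a / 2)) := by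
    intro t ht
    rw [uIcc_of_le (by linarith)] at ht
    exact ((hC.differentiableAt ξ t (by linarith [ht.1])).continuousAt.sub
      continuousAt_const).continuousWithinAt
  obtain ⟨t, ht, hte⟩ := intermediate_value_uIcc hcont hmem
  replace hte : Ψ ξ t - Ψ ξ (f ξ) = ε * g ξ := hte
  rw [uIcc_of_le (by linarith)] at ht
  have ht0 : 0 < t := by linarith [ht.1]
  have hex : ∃ t ∈ Ioi (0 : ℝ), Ψ ξ t = Ψ ξ (f ξ) + ε * g ξ := ⟨t, ht0, by linarith⟩
  -- Injectivity identifies the chosen preimage with the root from the intermediate value theorem,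
  -- hence locates it within `a / 2` of `f ξ`.
  have hmo : moAdd Ψ f g ε ξ = t := injOn_Ioi hΨ ξ (Function.invFunOn_mem hex) ht0
    ((Function.invFunOn_eq hex).trans (by linarith))
  refine ⟨by rw [hmo]; linarith [ht.1], Function.invFunOn_eq hex, ?_⟩
  rw [hmo]
  obtain ⟨c, hc, hce⟩ := exists_partialT_mul_eq_sub hC ξ (s := f ξ) (t := t) (by linarith) ht0
  have hcm : m ≤ |partialT Ψ ξ c| := by
    refine hm' ξ c ((le_min ?_ ?_).trans hc.1) (hc.2.trans (max_le ?_ ?_))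
    · linarith
    · linarith [ht.1]
    · linarith
    · linarith [ht.2]
  rw [div_mul_eq_mul_div, le_div_iff₀ hm]
  refine le_trans ?_ hεg
  rw [← hte, hce, abs_mul, mul_comm]
  gcongr

/-- The Musielak-Orlicz addition is differentiable at `ε = 0`, locally uniformly on `Ω`. -/
theorem tendsto_moAdd_sub_div (hΨ : IsClassCI Ψ ∨ IsClassCd Ψ) (hΩ : IsClosed Ω)
    (hf : ContinuousOn f Ω) (hf' : ∀ ξ ∈ Ω, 0 < f ξ) (hg : ContinuousOn g Ω) {η : Sph n}
    (hη : η ∈ Ω) :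
    Tendsto (fun p : ℝ × Sph n => ((moAdd Ψ f g p.1 p.2)⁻¹ - (f p.2)⁻¹) / p.1)
      (𝓝[≠] 0 ×ˢ 𝓝[Ω] η) (𝓝 (-(g η / partialT Ψ η (f η)) / f η ^ 2)) := by
  obtain ⟨δ, hδ, a, ha, C, hC0, haf, hmo⟩ := exists_moAdd_spec hΨ hΩ hf hf' hg
  have hC := isClassC_of_or hΨ
  -- The limit is joint in `ε` and the point of `Ω`, because the near-maximizers in Danskin's
  -- theorem move with `ε`.
  set l : Filter (ℝ × Sph n) := 𝓝[≠] 0 ×ˢ 𝓝[Ω] η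
  have hl1 : ∀ᶠ p in l, |p.1| < δ ∧ p.1 ≠ 0 :=
    tendsto_fst.eventually (eventually_abs_lt_and_ne_zero hδ)
  have hl2 : ∀ᶠ p in l, p.2 ∈ Ω := tendsto_snd.eventually self_mem_nhdsWithin
  have hfη : Tendsto (fun p : ℝ × Sph n => f p.2) l (𝓝 (f η)) := (hf η hη).tendsto.comp tendsto_snd
  have hgη : Tendsto (fun p : ℝ × Sph n => g p.2) l (𝓝 (g η)) := (hg η hη).tendsto.comp tendsto_snd
  have hε0 : Tendsto (fun p : ℝ × Sph n => C * |p.1|) l (𝓝 0) := by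
    have h1 : Tendsto (fun p : ℝ × Sph n => p.1) l (𝓝 0) :=
      (tendsto_fst : Tendsto _ l _).mono_right nhdsWithin_le_nhds
    simpa using h1.abs.const_mul C
  choose! c hc using fun (p : ℝ × Sph n) (h : 0 < f p.2 ∧ 0 < moAdd Ψ f g p.1 p.2) =>
    exists_partialT_mul_eq_sub hC p.2 h.1 h.2
  have hspec : ∀ᶠ p in l, 0 < f p.2 ∧ 0 < moAdd Ψ f g p.1 p.2 := by
    filter_upwards [hl1, hl2] with p h1 h2
    exact ⟨hf' _ h2, ha.trans_le (hmo p.1 h1.1 p.2 h2).1⟩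
  have hdist : ∀ᶠ p in l, |moAdd Ψ f g p.1 p.2 - f p.2| ≤ C * |p.1| := by
    filter_upwards [hl1, hl2] with p h1 h2
    exact (hmo p.1 h1.1 p.2 h2).2.2
  have htη : Tendsto (fun p : ℝ × Sph n => moAdd Ψ f g p.1 p.2) l (𝓝 (f η)) := by
    have := (squeeze_zero_norm' hdist hε0).add hfη
    simpa using this
  have hcη : Tendsto c l (𝓝 (f η)) := by
    have h1 : Tendsto (fun p => c p - f p.2) l (𝓝 0) := by
      refine squeeze_zero_norm' ?_ hε0
      filter_upwards [hdist, hspec] with p h1 h2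
      exact (abs_sub_left_of_mem_uIcc (hc p h2).1).trans h1
    simpa using h1.add hfη
  have hfη0 := hf' η hη
  have hpη : Tendsto (fun p => partialT Ψ p.2 (c p)) l (𝓝 (partialT Ψ η (f η))) := by
    have h1 : ContinuousAt (fun q : Sph n × ℝ => partialT Ψ q.1 q.2) (η, f η) :=
      hC.continuousOn_partialT.continuousAt ((isOpen_univ.prod isOpen_Ioi).mem_nhds
        ⟨mem_univ _, hfη0⟩)
    have h2 : Tendsto (fun p : ℝ × Sph n => (p.2, c p)) l (𝓝 (η, f η)) :=
      ((tendsto_snd : Tendsto _ l _).mono_right nhdsWithin_le_nhds).prodMk_nhds hcη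
    exact h1.tendsto.comp h2
  have hlim := (hgη.div hpη (partialT_ne_zero hΨ η hfη0)).neg.div (htη.mul hfη)
    (mul_pos hfη0 hfη0).ne'
  rw [← sq] at hlim
  refine hlim.congr' ?_
  filter_upwards [hl1, hl2, hspec] with p h1 h2 h3
  obtain ⟨h4, h5⟩ := hc p h3
  have h6 := (hmo p.1 h1.1 p.2 h2).2.1
  have hcp : 0 < c p := (lt_min h3.1 h3.2).trans_le h4.1
  have hp0 := partialT_ne_zero hΨ p.2 hcp
  have h7 : p.1 * g p.2 = partialT Ψ p.2 (c p) * (moAdd Ψ f g p.1 p.2 - f p.2) := by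
    rw [← h5, h6]; ring
  have h8 : g p.2 / partialT Ψ p.2 (c p) = (moAdd Ψ f g p.1 p.2 - f p.2) / p.1 := by
    rw [div_eq_div_iff hp0 h1.2]; linarith
  have h9 := h3.1.ne'
  have h10 := h3.2.ne'
  have h11 := h1.2
  simp only [Pi.div_apply, h8]
  field_simp
  ring

end MOAdd

/-! ### Danskin's theorem -/

section Danskin

variable {Ω : Set (Sph n)} {w w' : Sph n → ℝ} {v : ℝ → Sph n → ℝ}

/-- The set `{w(ξ) ξ : ξ ∈ Ω}`. -/
def scaledSet (Ω : Set (Sph n)) (w : Sph n → ℝ) : Set (Space n) :=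
  (fun ξ : Sph n => w ξ • (ξ : Space n)) '' Ω

theorem isBounded_scaledSet {R : ℝ} (h : ∀ ξ ∈ Ω, |w ξ| ≤ R) :
    Bornology.IsBounded (scaledSet Ω w) := by
  refine isBounded_iff_forall_norm_le.2 ⟨R, ?_⟩
  rintro _ ⟨ξ, hξ, rfl⟩
  simpa [norm_smul] using h ξ hξ

theorem supportFn_scaledSet_le {u : Sph n → ℝ} {s R : ℝ} (hΩ : Ω.Nonempty)
    (hu : ∀ ξ ∈ Ω, |u ξ| ≤ R) (h : ∀ ξ ∈ Ω, |w ξ - u ξ| ≤ s) (x : Space n) :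
    supportFn (scaledSet Ω w) x ≤ supportFn (scaledSet Ω u) x + s * ‖x‖ := by
  refine supportFn_le (hΩ.image _) ?_
  rintro _ ⟨ξ, hξ, rfl⟩
  have h1 := inner_le_supportFn (isBounded_scaledSet hu) (mem_image_of_mem _ hξ) x
  have h2 : (w ξ - u ξ) * inner ℝ x (ξ : Space n) ≤ s * ‖x‖ := by
    refine (le_abs_self _).trans ?_
    rw [abs_mul]
    have h3 := abs_real_inner_le_norm x (ξ : Space n)
    rw [norm_eq_of_mem_sphere, mul_one] at h3
    exact mul_le_mul (h ξ hξ) h3 (abs_nonneg _) ((abs_nonneg _).trans (h ξ hξ))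
  simp only [inner_smul_right] at h1 ⊢
  linarith

theorem isCompact_scaledSet (hΩ : IsClosed Ω) (hw : ContinuousOn w Ω) :
    IsCompact (scaledSet Ω w) :=
  hΩ.isCompact.image_of_continuousOn (hw.smul continuous_subtype_val.continuousOn)

/-- Danskin's theorem for the support functions of the sets `scaledSet Ω (v ε)`, at a point with a
unique maximizer. -/
theorem tendsto_supportFn_sub_div (hΩ : IsClosed Ω) (hw : ContinuousOn w Ω) {δ C : ℝ}
    (hδ : 0 < δ) (hv : ∀ ε, |ε| < δ → ∀ ξ ∈ Ω, |v ε ξ - w ξ| ≤ C * |ε|) {x : Space n} {η : Sph n}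
    (hη : η ∈ Ω) (hmax : w η * inner ℝ x (η : Space n) = supportFn (scaledSet Ω w) x)
    (huniq : ∀ ξ ∈ Ω, w ξ * inner ℝ x (ξ : Space n) = supportFn (scaledSet Ω w) x → ξ = η)
    {d : ℝ} (hd : Tendsto (fun p : ℝ × Sph n => (v p.1 p.2 - w p.2) / p.1)
      (𝓝[≠] 0 ×ˢ 𝓝[Ω] η) (𝓝 d)) :
    Tendsto (fun ε => (supportFn (scaledSet Ω (v ε)) x - supportFn (scaledSet Ω w) x) / ε)
      (𝓝[≠] 0) (𝓝 (inner ℝ x (η : Space n) * d)) := by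
  have hne : Ω.Nonempty := ⟨η, hη⟩
  obtain ⟨R, hR⟩ := hΩ.isCompact.exists_bound_of_continuousOn hw
  have hwb := isBounded_scaledSet hR
  have hle (ξ : Sph n) (hξ : ξ ∈ Ω) :
      w ξ * inner ℝ x (ξ : Space n) ≤ supportFn (scaledSet Ω w) x := by
    have := inner_le_supportFn hwb (mem_image_of_mem _ hξ) x
    simpa only [inner_smul_right] using this
  have hvR : ∀ ε, |ε| < δ → ∀ ξ ∈ Ω, |v ε ξ| ≤ R + C * |ε| := fun ε hε ξ hξ => by
    have h1 := hv ε hε ξ hξ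
    have h2 := hR ξ hξ
    rw [Real.norm_eq_abs] at h2
    have h3 := abs_add_le (v ε ξ - w ξ) (w ξ)
    rw [sub_add_cancel] at h3
    linarith
  have hle' (ε : ℝ) (hε : |ε| < δ) (ξ : Sph n) (hξ : ξ ∈ Ω) :
      v ε ξ * inner ℝ x (ξ : Space n) ≤ supportFn (scaledSet Ω (v ε)) x := by
    have := inner_le_supportFn (isBounded_scaledSet (hvR ε hε)) (mem_image_of_mem _ hξ) x
    simpa only [inner_smul_right] using this
  -- `v ε` is not assumed continuous, so a maximizer may fail to exist. An error of `ε ^ 2` is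
  -- harmless: after division by `ε` it contributes only `ε`.
  have hnear : ∀ ε : ℝ, ε ≠ 0 → ∃ ξ ∈ Ω,
      supportFn (scaledSet Ω (v ε)) x - ε ^ 2 < v ε ξ * inner ℝ x (ξ : Space n) := by
    intro ε hε
    obtain ⟨_, ⟨ξ, hξ, rfl⟩, h⟩ := exists_mem_lt_inner (Q := scaledSet Ω (v ε)) (hne.image _)
      (sub_lt_self (supportFn (scaledSet Ω (v ε)) x) (pow_pos (abs_pos.2 hε) 2))
    rw [sq_abs] at h
    exact ⟨ξ, hξ, by simpa only [inner_smul_right] using h⟩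
  have : Nonempty (Sph n) := ⟨η⟩
  choose! ζ hζ hζlt using hnear
  have hsmall := eventually_abs_lt_and_ne_zero hδ
  -- By uniqueness, outside a neighbourhood of `η` the unperturbed functional stays below its
  -- maximum by some `m > 0`, whereas `ζ ε` misses that maximum by at most `ε ^ 2 + 2 C |ε| ‖x‖`.
  have hζη : Tendsto ζ (𝓝[≠] 0) (𝓝[Ω] η) := by
    refine tendsto_nhdsWithin_iff.2 ⟨?_, hsmall.mono fun ε h => hζ ε h.2⟩
    refine tendsto_nhds.2 fun U hU hηU => ?_
    have hcont : ContinuousOn (fun ξ : Sph n => supportFn (scaledSet Ω w) x -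
        w ξ * inner ℝ x (ξ : Space n)) (Ω \ U) :=
      continuousOn_const.sub ((hw.mono sdiff_subset).mul (by fun_prop))
    obtain ⟨m, hm, hmU⟩ := (hΩ.isCompact.diff hU).exists_forall_le' (a := 0) hcont
      fun ξ hξ => sub_pos.2 (lt_of_le_of_ne (hle ξ hξ.1) fun h => hξ.2 (huniq ξ hξ.1 h ▸ hηU))
    have hlim : Tendsto (fun ε : ℝ => ε ^ 2 + 2 * (C * |ε| * ‖x‖)) (𝓝[≠] 0) (𝓝 0) := by
      have : Continuous fun ε : ℝ => ε ^ 2 + 2 * (C * |ε| * ‖x‖) := by fun_prop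
      simpa using (this.tendsto 0).mono_left nhdsWithin_le_nhds
    filter_upwards [hsmall, hlim.eventually_lt_const hm] with ε h1 h2
    by_contra hU'
    have h3 := hmU (ζ ε) ⟨hζ ε h1.2, hU'⟩
    have h4 := hζlt ε h1.2
    have h5 := supportFn_scaledSet_le (u := v ε) hne (hvR ε h1.1)
      (fun ξ hξ => (abs_sub_comm _ _).trans_le (hv ε h1.1 ξ hξ)) x
    have h6 : (v ε (ζ ε) - w (ζ ε)) * inner ℝ x (ζ ε : Space n) ≤ C * |ε| * ‖x‖ := by
      refine (le_abs_self _).trans ?_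
      rw [abs_mul]
      have h7 := abs_real_inner_le_norm x (ζ ε : Space n)
      rw [norm_eq_of_mem_sphere, mul_one] at h7
      have h8 := hv ε h1.1 _ (hζ ε h1.2)
      exact mul_le_mul h8 h7 (abs_nonneg _) ((abs_nonneg _).trans h8)
    linarith
  have hA : Tendsto (fun ε => inner ℝ x (η : Space n) * ((v ε η - w η) / ε)) (𝓝[≠] 0)
      (𝓝 (inner ℝ x (η : Space n) * d)) := by
    have h1 : Tendsto (fun ε : ℝ => (ε, η)) (𝓝[≠] 0) (𝓝[≠] 0 ×ˢ 𝓝[Ω] η) :=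
      tendsto_id.prodMk (tendsto_const_pure.mono_right (pure_le_nhdsWithin hη))
    exact (hd.comp h1).const_mul _
  have hB : Tendsto (fun ε => inner ℝ x (ζ ε : Space n) * ((v ε (ζ ε) - w (ζ ε)) / ε) + ε) (𝓝[≠] 0)
      (𝓝 (inner ℝ x (η : Space n) * d)) := by
    have h1 : Tendsto (fun ε : ℝ => (ε, ζ ε)) (𝓝[≠] 0) (𝓝[≠] 0 ×ˢ 𝓝[Ω] η) :=
      tendsto_id.prodMk hζη
    have h2 : Tendsto (fun ε => inner ℝ x (ζ ε : Space n)) (𝓝[≠] 0)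
        (𝓝 (inner ℝ x (η : Space n))) :=
      ((by fun_prop : Continuous fun ξ : Sph n => inner ℝ x (ξ : Space n)).tendsto η).comp
        (tendsto_nhds_of_tendsto_nhdsWithin hζη)
    have h3 : Tendsto (fun ε : ℝ => ε) (𝓝[≠] 0) (𝓝 0) :=
      tendsto_id.mono_left nhdsWithin_le_nhds
    simpa using (h2.mul (hd.comp h1)).add h3
  -- Testing with `η` and with `ζ ε` bounds the difference of support functions below and above.
  -- Division by a negative `ε` reverses the bounds, hence the minimum and maximum.
  refine tendsto_of_tendsto_of_tendsto_of_le_of_le' (by simpa using hA.min hB)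
    (by simpa using hA.max hB) ?_ ?_
  all_goals
    filter_upwards [hsmall] with ε h1
    have h2 := hle' ε h1.1 η hη
    have h3 := hle (ζ ε) (hζ ε h1.2)
    have h4 := hζlt ε h1.2
    have h5 : inner ℝ x (η : Space n) * ((v ε η - w η) / ε) =
        (v ε η * inner ℝ x (η : Space n) - w η * inner ℝ x (η : Space n)) / ε := by ring
    have h6 : inner ℝ x (ζ ε : Space n) * ((v ε (ζ ε) - w (ζ ε)) / ε) + ε =
        (v ε (ζ ε) * inner ℝ x (ζ ε : Space n) - w (ζ ε) * inner ℝ x (ζ ε : Space n) + ε ^ 2) / ε := by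
      have := h1.2
      field_simp
    rw [h5, h6]
    rcases lt_or_gt_of_ne h1.2 with h0 | h0
  · exact min_le_of_right_le (div_le_div_of_nonpos_of_le h0.le (by linarith))
  · exact min_le_of_left_le (div_le_div_of_nonneg_right (by linarith) h0.le)
  · exact le_max_of_le_left (div_le_div_of_nonpos_of_le h0.le (by linarith))
  · exact le_max_of_le_right (div_le_div_of_nonneg_right (by linarith) h0.le)

end Danskin

/-! ### Volume of a polar body -/

section Volume

variable {Q : Set (Space n)}

theorem convex_polarBody (hQ : Bornology.IsBounded Q) (hQ' : Q.Nonempty) :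
    Convex ℝ (polarBody Q) := by
  intro x hx y hy a b ha hb hab
  refine supportFn_le hQ' fun q hq => ?_
  have h1 := (inner_le_supportFn hQ hq x).trans hx
  have h2 := (inner_le_supportFn hQ hq y).trans hy
  rw [inner_add_left, inner_smul_left, inner_smul_left, conj_trivial, conj_trivial]
  nlinarith

/-- The volume of a polar body in polar coordinates. -/
theorem natCast_mul_volume_polarBody (hn : n ≠ 0) (hQ : Bornology.IsBounded Q) (hQ' : Q.Nonempty)
    (hpos : ∀ x ≠ 0, 0 < supportFn Q x) :
    n * volume.real (polarBody Q) = ∫ ξ : Sph n, (supportFn Q ξ)⁻¹ ^ n ∂sphMeasure n := by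
  have hm : Measurable fun ξ : Sph n => (supportFn Q ξ)⁻¹ :=
    ((continuous_supportFn hQ hQ').measurable.comp measurable_subtype_coe).inv
  have hR (ξ : Sph n) : 0 < (supportFn Q ξ)⁻¹ := inv_pos.2 (supportFn_sph_pos hpos ξ)
  have h1 := natCast_mul_volume_coneOver hn MeasurableSet.univ hm fun ξ _ => hR ξ
  have h2 : volume (polarBody Q) = volume (coneOver univ fun ξ : Sph n => (supportFn Q ξ)⁻¹) := by
    refine le_antisymm ?_ (measure_mono ?_)
    -- The open cone omits only the boundary and the origin, and the boundary of a convex set is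
    -- null.
    · have h3 : polarBody Q ⊆ (coneOver univ fun ξ : Sph n => (supportFn Q ξ)⁻¹) ∪
          (frontier (polarBody Q) ∪ {0}) := by
        intro x hx
        rcases eq_or_ne x 0 with rfl | hx0
        · exact Or.inr (Or.inr rfl)
        rcases (show supportFn Q x ≤ 1 from hx).eq_or_lt with h | h
        · refine Or.inr (Or.inl ?_)
          rwa [frontier_polarBody hQ hQ']
        · have hnx : 0 < ‖x‖ := norm_pos_iff.2 hx0
          refine Or.inl ⟨⟨‖x‖⁻¹ • x, by simp [norm_smul, hx0]⟩, mem_univ _, ‖x‖, ⟨hnx, ?_⟩, ?_⟩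
          · show ‖x‖ < (supportFn Q (‖x‖⁻¹ • x))⁻¹
            rw [supportFn_smul Q (inv_nonneg.2 hnx.le), mul_inv, inv_inv]
            exact lt_mul_of_one_lt_right hnx ((one_lt_inv₀ (hpos x hx0)).2 h)
          · simp [smul_smul, hnx.ne']
      have : Nontrivial (Space n) :=
        Module.nontrivial_of_finrank_pos (R := ℝ) (by simpa using Nat.pos_of_ne_zero hn)
      have h4 : volume (frontier (polarBody Q) ∪ {(0 : Space n)}) = 0 :=
        measure_union_null ((convex_polarBody hQ hQ').addHaar_frontier volume)
          (measure_singleton _)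
      refine (measure_mono h3).trans ((measure_union_le _ _).trans ?_)
      rw [h4, add_zero]
    · rintro _ ⟨ξ, -, r, hr, rfl⟩
      rw [polarBody, mem_ofPred_eq, supportFn_smul Q hr.1.le]
      have := supportFn_sph_pos hpos ξ
      rw [← le_div_iff₀ this, one_div]
      exact hr.2.le
  rw [measureReal_def, h2, ← ENNReal.toReal_natCast, ← ENNReal.toReal_mul, h1,
    Measure.restrict_univ, ← integral_eq_lintegral_of_nonneg_ae]
  · exact Eventually.of_forall fun ξ => pow_nonneg (hR ξ).le n
  · exact (hm.pow_const n).aestronglyMeasurable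

end Volume

/-! ### Variation of the Wulff shape -/

section Wulff

variable {Ω : Set (Sph n)} {f g : Sph n → ℝ} {Ψ : Sph n → ℝ → ℝ}

theorem nonempty_of_not_subset_closedHemisphere (hn : n ≠ 0)
    (hΩ : ∀ v : Sph n, ¬ Ω ⊆ closedHemisphere v) : Ω.Nonempty := by
  have : Nontrivial (Space n) :=
    Module.nontrivial_of_finrank_pos (R := ℝ) (by simpa using Nat.pos_of_ne_zero hn)
  obtain ⟨v, hv⟩ := NormedSpace.sphere_nonempty (x := (0 : Space n)) (r := 1) |>.2 zero_le_one
  exact nonempty_iff_ne_empty.2 fun h => hΩ ⟨v, hv⟩ (h ▸ empty_subset _)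

/-- `Ω` is not contained in the hemisphere with pole `-x / ‖x‖`, so some `ξ ∈ Ω` satisfies `x ⬝ ξ >
0`. -/
theorem supportFn_scaledSet_pos (hΩ : ∀ v : Sph n, ¬ Ω ⊆ closedHemisphere v) {w : Sph n → ℝ}
    (hw : ∀ ξ ∈ Ω, 0 < w ξ) (hb : Bornology.IsBounded (scaledSet Ω w)) {x : Space n}
    (hx : x ≠ 0) : 0 < supportFn (scaledSet Ω w) x := by
  obtain ⟨ξ, hξ, h⟩ := not_subset.1 (hΩ ⟨-(‖x‖⁻¹ • x), by simp [norm_smul, hx]⟩)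
  rw [closedHemisphere, mem_ofPred_eq, inner_neg_left, inner_smul_left, conj_trivial, not_le,
    neg_lt_zero] at h
  have h1 : 0 < inner ℝ x (ξ : Space n) :=
    pos_of_mul_pos_right h (inv_nonneg.2 (norm_nonneg x))
  have h2 := inner_le_supportFn hb (mem_image_of_mem _ hξ) x
  rw [inner_smul_right] at h2
  exact (mul_pos (hw ξ hξ) h1).trans_le h2

theorem wulffShape_eq_polarBody (hΩ : Ω.Nonempty) (hf : ∀ ξ ∈ Ω, 0 < f ξ)
    (hb : Bornology.IsBounded (scaledSet Ω fun ξ => (f ξ)⁻¹)) :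
    wulffShape Ω f = polarBody (scaledSet Ω fun ξ => (f ξ)⁻¹) := by
  ext x
  rw [wulffShape, mem_iInter₂]
  constructor
  · intro h
    refine supportFn_le (hΩ.image _) ?_
    rintro _ ⟨ξ, hξ, rfl⟩
    rw [inner_smul_right, inv_mul_le_iff₀ (hf ξ hξ), mul_one]
    exact h ξ hξ
  · intro h ξ hξ
    have h1 := (inner_le_supportFn hb (mem_image_of_mem _ hξ) x).trans h
    rwa [inner_smul_right, inv_mul_le_iff₀ (hf ξ hξ), mul_one] at h1

/-- The gradient is a point `w(η) η` of the set, and its direction is `η`. In particular almost all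
normals of the Wulff shape lie in `Ω`. -/
theorem gradient_scaledSet (hΩ : IsClosed Ω) (hΩ' : ∀ v : Sph n, ¬ Ω ⊆ closedHemisphere v)
    (hne : Ω.Nonempty) {w : Sph n → ℝ} (hw : ContinuousOn w Ω) (hw' : ∀ ξ ∈ Ω, 0 < w ξ)
    {ξ : Sph n} (hd : DifferentiableAt ℝ (supportFn (scaledSet Ω w)) (ξ : Space n)) :
    unitNormal (scaledSet Ω w) ξ ∈ Ω ∧
      ‖gradient (supportFn (scaledSet Ω w)) ξ‖ = w (unitNormal (scaledSet Ω w) ξ) ∧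
      gradient (supportFn (scaledSet Ω w)) ξ =
        w (unitNormal (scaledSet Ω w) ξ) • (unitNormal (scaledSet Ω w) ξ : Space n) := by
  have hQ := isCompact_scaledSet hΩ hw
  have hpos : ∀ x ≠ 0, 0 < supportFn (scaledSet Ω w) x := fun x hx =>
    supportFn_scaledSet_pos hΩ' hw' hQ.isBounded hx
  obtain ⟨η, hη, h⟩ := (inner_gradient_supportFn hQ (hne.image _) hd).1
  have hp0 := gradient_supportFn_ne_zero hQ (hne.image _) hpos hd
  have hwη := hw' η hη
  have hnorm : ‖gradient (supportFn (scaledSet Ω w)) ξ‖ = w η := by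
    rw [← h, norm_smul, norm_eq_of_mem_sphere, mul_one, Real.norm_of_nonneg hwη.le]
  have hN : unitNormal (scaledSet Ω w) ξ = η := by
    refine Subtype.ext ?_
    rw [coe_unitNormal hp0, hnorm, ← h, smul_smul, inv_mul_cancel₀ hwη.ne', one_smul]
  rw [hN]
  exact ⟨hη, hnorm, h.symm⟩

/-- The variation of the support function of the polar set of the Wulff shape. -/
theorem hasDerivAt_supportFn_moAdd (hΨ : IsClassCI Ψ ∨ IsClassCd Ψ) (hΩ : IsClosed Ω)
    (hΩ' : ∀ v : Sph n, ¬ Ω ⊆ closedHemisphere v) (hne : Ω.Nonempty) (hf : ContinuousOn f Ω)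
    (hf' : ∀ ξ ∈ Ω, 0 < f ξ) (hg : ContinuousOn g Ω) {δ C : ℝ} (hδ : 0 < δ)
    (hv : ∀ ε, |ε| < δ → ∀ ξ ∈ Ω, |(moAdd Ψ f g ε ξ)⁻¹ - (f ξ)⁻¹| ≤ C * |ε|) {ξ : Sph n}
    (hd : DifferentiableAt ℝ (supportFn (scaledSet Ω fun ξ => (f ξ)⁻¹)) (ξ : Space n)) :
    HasDerivAt (fun ε => supportFn (scaledSet Ω fun ξ => (moAdd Ψ f g ε ξ)⁻¹) ξ)
      (-(supportFn (scaledSet Ω fun ξ => (f ξ)⁻¹) ξ *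
        ‖gradient (supportFn (scaledSet Ω fun ξ => (f ξ)⁻¹)) ξ‖ *
        (g (unitNormal (scaledSet Ω fun ξ => (f ξ)⁻¹) ξ) *
          moDensity Ψ (polarBody (scaledSet Ω fun ξ => (f ξ)⁻¹))
            (unitNormal (scaledSet Ω fun ξ => (f ξ)⁻¹) ξ)))) 0 := by
  set w : Sph n → ℝ := fun ξ => (f ξ)⁻¹ with hw_def
  have hw : ContinuousOn w Ω := hf.inv₀ fun ξ hξ => (hf' ξ hξ).ne'
  have hw' : ∀ ξ ∈ Ω, 0 < w ξ := fun ξ hξ => inv_pos.2 (hf' ξ hξ)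
  have hQ := isCompact_scaledSet hΩ hw
  have hpos : ∀ x ≠ 0, 0 < supportFn (scaledSet Ω w) x := fun x hx =>
    supportFn_scaledSet_pos hΩ' hw' hQ.isBounded hx
  obtain ⟨hη, hnorm, hgrad⟩ := gradient_scaledSet hΩ hΩ' hne hw hw' hd
  have hsupp := supportFn_polarBody_unitNormal hQ (hne.image _) hpos hd
  set η := unitNormal (scaledSet Ω w) ξ
  have hmax : w η * inner ℝ (ξ : Space n) (η : Space n) = supportFn (scaledSet Ω w) ξ := by
    rw [← (inner_gradient_supportFn hQ (hne.image _) hd).2, hgrad, inner_smul_right]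
  -- Each maximizing `ζ` gives the same gradient `w(ζ) ζ`; its norm determines `w(ζ)`, and then `ζ`
  -- itself.
  have huniq : ∀ ζ ∈ Ω, w ζ * inner ℝ (ξ : Space n) (ζ : Space n) =
      supportFn (scaledSet Ω w) ξ → ζ = η := by
    intro ζ hζ h
    have h1 := gradient_eq_of_inner_le hd
      (fun y => inner_le_supportFn hQ.isBounded (mem_image_of_mem _ hζ) y)
      (inner_smul_right _ _ _ |>.trans h)
    have h2 : w ζ = w η := by
      rw [← hnorm, h1, norm_smul, norm_eq_of_mem_sphere, mul_one,
        Real.norm_of_nonneg (hw' ζ hζ).le]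
    rw [hgrad, h2] at h1
    exact Subtype.ext (smul_right_injective _ (hw' η hη).ne' h1).symm
  have hlim := tendsto_supportFn_sub_div hΩ hw hδ hv hη hmax huniq
    (tendsto_moAdd_sub_div hΨ hΩ hf hf' hg hη)
  have h0 : supportFn (scaledSet Ω fun ξ => (moAdd Ψ f g 0 ξ)⁻¹) ξ =
      supportFn (scaledSet Ω w) ξ := by
    have : scaledSet Ω (fun ξ => (moAdd Ψ f g 0 ξ)⁻¹) = scaledSet Ω w := by
      refine image_congr fun ζ hζ => ?_
      have := hv 0 (by simpa using hδ) ζ hζ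
      rw [abs_zero, mul_zero, abs_nonpos_iff, sub_eq_zero] at this
      simp only [this, hw_def]
    rw [this]
  rw [hasDerivAt_iff_tendsto_slope]
  have hfη := hf' η hη
  have hval : inner ℝ (ξ : Space n) (η : Space n) * (-(g η / partialT Ψ η (f η)) / f η ^ 2) =
      -(supportFn (scaledSet Ω w) ξ * ‖gradient (supportFn (scaledSet Ω w)) ξ‖ *
        (g η * moDensity Ψ (polarBody (scaledSet Ω w)) η)) := by
    rw [moDensity, hsupp, hnorm, ← hmax, hw_def]
    simp only [inv_inv]
    have := partialT_ne_zero hΨ η hfη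
    field_simp
  rw [hval] at hlim
  refine hlim.congr fun ε => ?_
  rw [slope_def_field, h0, sub_zero]

/-- Used with exponent 1 for the reciprocals of `f_ε`, and with exponent `n` for the dominating
constant in the volume integral. -/
theorem abs_inv_pow_sub_inv_pow_le {a b c : ℝ} (hc : 0 < c) (ha : c ≤ a) (hb : c ≤ b) (n : ℕ) :
    |a⁻¹ ^ n - b⁻¹ ^ n| ≤ n * c⁻¹ ^ (n - 1) * (c⁻¹ * c⁻¹) * |a - b| := by
  have ha0 := hc.trans_le ha
  have hb0 := hc.trans_le hb
  have h1 : a⁻¹ ≤ c⁻¹ := inv_anti₀ hc ha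
  have h2 : b⁻¹ ≤ c⁻¹ := inv_anti₀ hc hb
  have h3 : |a⁻¹ - b⁻¹| ≤ (c⁻¹ * c⁻¹) * |a - b| := by
    rw [inv_sub_inv ha0.ne' hb0.ne', abs_div, abs_of_pos (mul_pos ha0 hb0), abs_sub_comm,
      div_eq_inv_mul, mul_inv]
    gcongr
  have h4 : max |a⁻¹| |b⁻¹| ≤ c⁻¹ := by
    rw [abs_of_pos (inv_pos.2 ha0), abs_of_pos (inv_pos.2 hb0)]
    exact max_le h1 h2
  calc |a⁻¹ ^ n - b⁻¹ ^ n| ≤ |a⁻¹ - b⁻¹| * n * max |a⁻¹| |b⁻¹| ^ (n - 1) := abs_pow_sub_pow_le _ _ _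
    _ ≤ (c⁻¹ * c⁻¹) * |a - b| * n * c⁻¹ ^ (n - 1) := by gcongr
    _ = _ := by ring

/-- The variational formula for the volume of the Wulff shape. -/
theorem tendsto_volume_wulffShape_sub_div (hn : n ≠ 0) (hΨ : IsClassCI Ψ ∨ IsClassCd Ψ)
    (hΩ : IsClosed Ω) (hΩ' : ∀ v : Sph n, ¬ Ω ⊆ closedHemisphere v) (hf : ContinuousOn f Ω)
    (hf' : ∀ ξ ∈ Ω, 0 < f ξ) (hg : Continuous g) :
    Tendsto (fun ε : ℝ =>
        (volume.real (wulffShape Ω (moAdd Ψ f g ε)) - volume.real (wulffShape Ω f)) / ε)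
      (𝓝[≠] 0) (𝓝 (∫ u in Ω, g u * moDensity Ψ (wulffShape Ω f) u
        ∂surfaceMeasure (scaledSet Ω fun ξ => (f ξ)⁻¹))) := by
  have hne := nonempty_of_not_subset_closedHemisphere hn hΩ'
  obtain ⟨δ, hδ, a, ha, C, hC, haf, hmo⟩ := exists_moAdd_spec hΨ hΩ hf hf' hg.continuousOn
  set w : Sph n → ℝ := fun ξ => (f ξ)⁻¹ with hw_def
  set v : ℝ → Sph n → ℝ := fun ε ξ => (moAdd Ψ f g ε ξ)⁻¹
  have hw : ContinuousOn w Ω := hf.inv₀ fun ξ hξ => (hf' ξ hξ).ne'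
  have hw' : ∀ ξ ∈ Ω, 0 < w ξ := fun ξ hξ => inv_pos.2 (hf' ξ hξ)
  have hQ := isCompact_scaledSet hΩ hw
  have hQne : (scaledSet Ω w).Nonempty := hne.image _
  have hpos : ∀ x ≠ 0, 0 < supportFn (scaledSet Ω w) x := fun x hx =>
    supportFn_scaledSet_pos hΩ' hw' hQ.isBounded hx
  have hK : wulffShape Ω f = polarBody (scaledSet Ω w) :=
    wulffShape_eq_polarBody hne hf' hQ.isBounded
  have hmo' : ∀ ε, |ε| < δ → ∀ ξ ∈ Ω, 0 < moAdd Ψ f g ε ξ := fun ε hε ξ hξ =>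
    ha.trans_le (hmo ε hε ξ hξ).1
  have hwa : ∀ ξ ∈ Ω, |w ξ| ≤ a⁻¹ := fun ξ hξ => by
    rw [abs_of_pos (hw' ξ hξ)]
    exact inv_anti₀ ha (haf ξ hξ)
  have hva : ∀ ε, |ε| < δ → ∀ ξ ∈ Ω, |v ε ξ| ≤ a⁻¹ := fun ε hε ξ hξ => by
    rw [abs_of_pos (inv_pos.2 (hmo' ε hε ξ hξ))]
    exact inv_anti₀ ha (hmo ε hε ξ hξ).1
  have hv : ∀ ε, |ε| < δ → ∀ ξ ∈ Ω, |v ε ξ - w ξ| ≤ (a⁻¹ * a⁻¹ * C) * |ε| := fun ε hε ξ hξ => by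
    have h1 := abs_inv_pow_sub_inv_pow_le ha (hmo ε hε ξ hξ).1 (haf ξ hξ) 1
    simp only [pow_one, Nat.cast_one, Nat.sub_self, pow_zero, one_mul] at h1
    refine h1.trans ?_
    rw [mul_assoc _ C]
    exact mul_le_mul_of_nonneg_left (hmo ε hε ξ hξ).2.2 (by positivity)
  set C' := a⁻¹ * a⁻¹ * C
  have hC' : 0 ≤ C' := by positivity
  set G : ℝ → Sph n → ℝ := fun ε ξ => supportFn (scaledSet Ω (v ε)) ξ with hG
  set G₀ : Sph n → ℝ := fun ξ => supportFn (scaledSet Ω w) ξ with hG₀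
  have hvb : ∀ ε, |ε| < δ → Bornology.IsBounded (scaledSet Ω (v ε)) := fun ε hε =>
    isBounded_scaledSet (hva ε hε)
  have hvpos : ∀ ε, |ε| < δ → ∀ x ≠ 0, 0 < supportFn (scaledSet Ω (v ε)) x := fun ε hε x hx =>
    supportFn_scaledSet_pos hΩ' (fun ξ hξ => inv_pos.2 (hmo' ε hε ξ hξ)) (hvb ε hε) hx
  have hGdist : ∀ ε, |ε| < δ → ∀ ξ, |G ε ξ - G₀ ξ| ≤ C' * |ε| := by
    intro ε hε ξ
    have h1 := supportFn_scaledSet_le hne hwa (hv ε hε) (ξ : Space n)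
    have h2 := supportFn_scaledSet_le hne (hva ε hε)
      (fun ξ hξ => (abs_sub_comm _ _).trans_le (hv ε hε ξ hξ)) (ξ : Space n)
    rw [norm_eq_of_mem_sphere, mul_one] at h1 h2
    rw [abs_le]
    constructor <;> simp only [hG, hG₀] <;> linarith
  obtain ⟨c, hc, hcG⟩ := exists_pos_mul_norm_le_supportFn hQ.isBounded hQne hpos
  have hcG₀ : ∀ ξ, c ≤ G₀ ξ := fun ξ => by simpa using hcG (ξ : Space n)
  -- The last condition keeps `G ε ≥ c / 2`, so the difference quotients of its inverse powers are
  -- bounded by a constant.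
  have hsmall : ∀ᶠ ε : ℝ in 𝓝[≠] 0, |ε| < δ ∧ ε ≠ 0 ∧ C' * |ε| ≤ c / 2 := by
    have h1 : Tendsto (fun ε : ℝ => C' * |ε|) (𝓝[≠] 0) (𝓝 0) := by
      have : Continuous fun ε : ℝ => C' * |ε| := by fun_prop
      simpa using (this.tendsto 0).mono_left nhdsWithin_le_nhds
    filter_upwards [eventually_abs_lt_and_ne_zero hδ, h1.eventually_lt_const (half_pos hc)]
      with ε h2 h3
    exact ⟨h2.1, h2.2, h3.le⟩
  have hmeas : ∀ Q : Set (Space n), Bornology.IsBounded Q → Q.Nonempty →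
      Measurable fun ξ : Sph n => (supportFn Q ξ)⁻¹ ^ n := fun Q hQ hQ' =>
    ((continuous_supportFn hQ hQ').measurable.comp measurable_subtype_coe).inv.pow_const n
  have hint : ∀ Q : Set (Space n), Bornology.IsBounded Q → Q.Nonempty →
      (∀ x ≠ 0, 0 < supportFn Q x) →
      Integrable (fun ξ : Sph n => (supportFn Q ξ)⁻¹ ^ n) (sphMeasure n) := fun Q hQ hQ' hp =>
    Continuous.integrable_of_hasCompactSupport
      ((((continuous_supportFn hQ hQ').comp continuous_subtype_val).inv₀
        fun ξ => (supportFn_sph_pos hp ξ).ne').pow n) (HasCompactSupport.of_compactSpace _)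
  have hlim : Tendsto (fun ε : ℝ =>
        ∫ ξ, ((G ε ξ)⁻¹ ^ n - (G₀ ξ)⁻¹ ^ n) / ε ∂sphMeasure n) (𝓝[≠] 0)
      (𝓝 (∫ ξ, n * ((G₀ ξ)⁻¹ ^ n * ‖gradient (supportFn (scaledSet Ω w)) ξ‖ *
        (g (unitNormal (scaledSet Ω w) ξ) * moDensity Ψ (polarBody (scaledSet Ω w))
          (unitNormal (scaledSet Ω w) ξ))) ∂sphMeasure n)) := by
    refine tendsto_integral_filter_of_dominated_convergence
      (fun _ => n * (c / 2)⁻¹ ^ (n - 1) * ((c / 2)⁻¹ * (c / 2)⁻¹) * C') ?_ ?_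
      (integrable_const _) ?_
    · filter_upwards [hsmall] with ε hε
      exact (((hmeas _ (hvb ε hε.1) (hne.image _)).sub
        (hmeas _ hQ.isBounded hQne)).div_const ε).aestronglyMeasurable
    · filter_upwards [hsmall] with ε hε
      refine Eventually.of_forall fun ξ => ?_
      have h1 := hGdist ε hε.1 ξ
      have h2 := hcG₀ ξ
      have h3 : c / 2 ≤ G ε ξ := by
        have := (abs_le.1 h1).1
        linarith [hε.2.2]
      rw [Real.norm_eq_abs, abs_div, div_le_iff₀ (abs_pos.2 hε.2.1)]
      refine (abs_inv_pow_sub_inv_pow_le (half_pos hc) h3 (by linarith) n).trans ?_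
      rw [mul_assoc _ C']
      gcongr
    · filter_upwards [ae_differentiableAt_supportFn hn hQ.isBounded hQne] with ξ hd
      have h1 := hasDerivAt_supportFn_moAdd hΨ hΩ hΩ' hne hf hf' hg.continuousOn hδ hv hd
      have h0 : G 0 ξ = G₀ ξ := by
        have := hGdist 0 (by simpa using hδ) ξ
        rwa [abs_zero, mul_zero, abs_nonpos_iff, sub_eq_zero] at this
      have hG0 : G₀ ξ ≠ 0 := (supportFn_sph_pos hpos ξ).ne'
      have h2 := (h1.fun_inv (h0.trans_ne hG0)).fun_pow n
      have h3 := hasDerivAt_iff_tendsto_slope.1 h2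
      have h4 : supportFn (scaledSet Ω fun ξ => (moAdd Ψ f g 0 ξ)⁻¹) ξ = G₀ ξ := h0
      rw [h4] at h3
      convert h3.congr fun ε => ?_ using 2
      · obtain ⟨m, rfl⟩ := Nat.exists_eq_succ_of_ne_zero hn
        simp only [Nat.succ_eq_add_one, Nat.add_sub_cancel]
        simp only [← hw_def]
        rw [show supportFn (scaledSet Ω w) (ξ : Space (m + 1)) = G₀ ξ from rfl, pow_succ]
        field_simp
      · rw [slope_def_field, h4, sub_zero]
  have hvol : ∀ ε, |ε| < δ → wulffShape Ω (moAdd Ψ f g ε) = polarBody (scaledSet Ω (v ε)) :=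
    fun ε hε => wulffShape_eq_polarBody hne (hmo' ε hε) (hvb ε hε)
  have hn' : (n : ℝ) ≠ 0 := by exact_mod_cast hn
  have hden := continuous_moDensity hΨ hQ hQne hpos
  have hend : ∫ u in Ω, g u * moDensity Ψ (wulffShape Ω f) u ∂surfaceMeasure (scaledSet Ω w) =
      ∫ ξ, ((G₀ ξ)⁻¹ ^ n * ‖gradient (supportFn (scaledSet Ω w)) ξ‖ *
        (g (unitNormal (scaledSet Ω w) ξ) * moDensity Ψ (polarBody (scaledSet Ω w))
          (unitNormal (scaledSet Ω w) ξ))) ∂sphMeasure n := by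
    rw [hK, setIntegral_surfaceMeasure hQ.isBounded hQne hpos
      (φ := fun u => g u * moDensity Ψ _ u) (hg.mul hden).measurable hΩ.measurableSet]
    -- Almost every normal lies in `Ω`, so restricting to `Ω` loses nothing.
    have : unitNormal (scaledSet Ω w) ⁻¹' Ω =ᵐ[sphMeasure n] univ := by
      filter_upwards [ae_differentiableAt_supportFn hn hQ.isBounded hQne] with ξ hd
      exact propext (iff_of_true (gradient_scaledSet hΩ hΩ' hne hw hw' hd).1 trivial)
    rw [setIntegral_congr_set this, setIntegral_univ]
  rw [hend]
  rw [integral_const_mul] at hlim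
  have h5 := hlim.const_mul (n : ℝ)⁻¹
  rw [inv_mul_cancel_left₀ hn'] at h5
  refine h5.congr' ?_
  filter_upwards [hsmall] with ε hε
  have h6 := natCast_mul_volume_polarBody hn (hvb ε hε.1) (hne.image _) (hvpos ε hε.1)
  have h7 := natCast_mul_volume_polarBody hn hQ.isBounded hQne hpos
  rw [integral_div, integral_sub (hint _ (hvb ε hε.1) (hne.image _) (hvpos ε hε.1))
    (hint _ hQ.isBounded hQne hpos), ← h6, ← h7, hvol ε hε.1, hK, ← mul_sub, mul_div_assoc,
    inv_mul_cancel_left₀ hn']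

end Wulff

end MusielakOrlicz

end

/-! ### The main theorem -/

open MusielakOrlicz in
theorem mainTheorem12 (n : ℕ) (hn : 2 ≤ n)
    (Ψ : Sph n → ℝ → ℝ) (hΨ : IsClassCI Ψ ∨ IsClassCd Ψ)
    (Ω : Set (Sph n)) (hΩ : IsClosed Ω) (hΩ' : ∀ v : Sph n, ¬ Ω ⊆ closedHemisphere v)
    (f g : Sph n → ℝ) (hf : ContinuousOn f Ω) (hf' : ∀ ξ ∈ Ω, 0 < f ξ)
    (hg : ContinuousOn g Ω) :
    -- the Musielak-Orlicz addition is well defined for all small `ε`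
    (∃ δ > 0, ∀ ε : ℝ, |ε| < δ → ∀ ξ ∈ Ω,
      0 < moAdd Ψ f g ε ξ ∧ Ψ ξ (moAdd Ψ f g ε ξ) = Ψ ξ (f ξ) + ε * g ξ) ∧
    ∃ S : SignedMeasure (Sph n),
      -- `S` is the Musielak-Orlicz surface area measure of `[f]`
      IsMOSurfaceAreaMeasure Ψ (wulffShape Ω f) S ∧
      -- its density with respect to the surface area measure of `[f]`
      (∃ σ : Measure (Sph n), IsSurfaceAreaMeasure (wulffShape Ω f) σ ∧
        Integrable (fun u : Sph n =>
          1 / partialT Ψ u (supportFn (wulffShape Ω f) (u : Space n))) σ ∧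
        S = σ.withDensityᵥ (fun u : Sph n =>
          1 / partialT Ψ u (supportFn (wulffShape Ω f) (u : Space n)))) ∧
      -- the variational formula
      VectorMeasure.IntegrableOn S g Ω ∧
      Tendsto (fun ε : ℝ =>
          (volume.real (wulffShape Ω (moAdd Ψ f g ε)) - volume.real (wulffShape Ω f)) / ε)
        (𝓝[≠] 0) (𝓝 (∫ᵛ u in Ω, g u ∂<•S)) := by
  have hn0 : n ≠ 0 := by omega
  have hne := nonempty_of_not_subset_closedHemisphere hn0 hΩ'
  obtain ⟨δ, hδ, a, ha, C, -, -, hmo⟩ := exists_moAdd_spec hΨ hΩ hf hf' hg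
  refine ⟨⟨δ, hδ, fun ε hε ξ hξ =>
    ⟨ha.trans_le (hmo ε hε ξ hξ).1, (hmo ε hε ξ hξ).2.1⟩⟩, ?_⟩
  have hw : ContinuousOn (fun ξ => (f ξ)⁻¹) Ω := hf.inv₀ fun ξ hξ => (hf' ξ hξ).ne'
  have hQ := isCompact_scaledSet hΩ hw
  have hQne : (scaledSet Ω fun ξ => (f ξ)⁻¹).Nonempty := hne.image _
  have hpos : ∀ x ≠ 0, 0 < supportFn (scaledSet Ω fun ξ => (f ξ)⁻¹) x := fun x hx =>
    supportFn_scaledSet_pos hΩ' (fun ξ hξ => inv_pos.2 (hf' ξ hξ)) hQ.isBounded hx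
  have hK := wulffShape_eq_polarBody hne hf' hQ.isBounded
  -- Tietze extension: `g` is continuous only on `Ω`, while the volume formula takes a continuous
  -- function on the sphere. Both sides of the formula depend only on the values on `Ω`.
  obtain ⟨g', hg'⟩ := ContinuousMap.exists_restrict_eq hΩ ⟨Ω.domRestrict g, hg.domRestrict⟩
  have hgg' : EqOn g g' Ω := fun ξ hξ => (congrArg (fun h : C(Ω, ℝ) => h ⟨ξ, hξ⟩) hg').symm
  have hden := continuous_moDensity hΨ hQ hQne hpos
  have hi := integrable_moDensity hΨ hQ hQne hpos
  have := isFiniteMeasure_surfaceMeasure hQ hQne hpos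
  have hgi : IntegrableOn (fun u => g u * moDensity Ψ (wulffShape Ω f) u) Ω
      (surfaceMeasure (scaledSet Ω fun ξ => (f ξ)⁻¹)) := by
    rw [hK]
    refine IntegrableOn.congr_fun (f := fun u => g' u * moDensity Ψ _ u)
      ((g'.continuous.mul hden).integrable_of_hasCompactSupport
        (HasCompactSupport.of_compactSpace _)).integrableOn
      (fun u hu => by simp only [hgg' hu]) hΩ.measurableSet
  refine ⟨(surfaceMeasure (scaledSet Ω fun ξ => (f ξ)⁻¹)).withDensityᵥ
    (moDensity Ψ (wulffShape Ω f)), ?_, ⟨surfaceMeasure (scaledSet Ω fun ξ => (f ξ)⁻¹), ?_, ?_, rfl⟩,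
    ?_⟩
  · rw [hK]
    exact isMOSurfaceAreaMeasure hn0 hΨ hQ hQne hpos
  · rw [hK]
    exact isSurfaceAreaMeasure_surfaceMeasure hn0 hQ hQne hpos
  · rw [hK]
    exact hi
  · obtain ⟨h1, h2⟩ := integrableOn_withDensityᵥ (hK ▸ hden.measurable) (hK ▸ hi)
      (hK ▸ moDensity_sign hΨ hQ hQne hpos) hΩ.measurableSet hgi
    refine ⟨h1, ?_⟩
    rw [h2, setIntegral_congr_fun (g := fun u => g' u * moDensity Ψ (wulffShape Ω f) u)
      hΩ.measurableSet fun u hu => by simp only [hgg' hu]]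
    refine (tendsto_volume_wulffShape_sub_div hn0 hΨ hΩ hΩ' hf hf' g'.continuous).congr fun ε => ?_
    have : wulffShape Ω (moAdd Ψ f g' ε) = wulffShape Ω (moAdd Ψ f g ε) :=
      iInter₂_congr fun ξ hξ => by simp only [moAdd, hgg' hξ]
    rw [this]
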